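/- **Theorem (Kostant–Parthasarathy formula for $t=1/3$).** *Setting.* Let $G$ be a (finite-dimensional) Lie group, $H\subset G$ a closed subgroup, with Lie algebras $\mathfrak h\subset\mathfrak g$, and let $\mathfrak g=\mathfrak h\oplus\mathfrak m$ be a reductive decomposition, $\mathrm{Ad}(H)\mathfrak m\subset\mathfrak m$; write $X=X_{\mathfrak h}+X_{\mathfrak m}$. Let $\langle\,,\rangle$ be an $\mathrm{Ad}(H)$-invariant inner product on $\mathfrak m$ (a $G$-invariant Riemannian metric on $M=G/H$) which is naturally reductive: $\langle[X,Y]_{\mathfrak m},Z\rangle+\langle Y,[X,Z]_{\mathfrak m}\rangle=0$ for $X,Y,Z\in\mathfrak m$. Let $Q$ be an $\mathrm{Ad}(G)$-invariant extension of $\langle\,,\rangle$, i.e. a symmetric, non-degenerate, $\mathrm{Ad}(G)$-invariant bilinear form on $\mathfrak g$ with $Q(\mathfrak h,\mathfrak m)=0$ and $Q|_{\mathfrak m}=\langle\,,\rangle$; put $Q_{\mathfrak h}(X,Y)=Q(X_{\mathfrak h},Y_{\mathfrak h})$, $Q_{\mathfrak m}(X,Y)=Q(X_{\mathfrak m},Y_{\mathfrak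 m})$. Let $\mathcal C(\mathfrak m)$ be the Clifford algebra with $v\cdot w+w\cdot v=-2\langle v,w\rangle$, $\lambda:\mathrm{Spin}(\mathfrak m)\to\mathrm{SO}(\mathfrak m)$ the spin covering, $\Delta$ the spin module (an irreducible complex module over $\mathcal C(\mathfrak m)$), and let $\widetilde{\mathrm{Ad}}:H\to\mathrm{Spin}(\mathfrak m)$ be a homogeneous spin structure, i.e. a smooth homomorphism lifting $\mathrm{Ad}:H\to \mathrm{SO}(\mathfrak m)$. For $A\in\mathfrak{so}(\mathfrak m)$ let $\tilde A=d\lambda^{-1}(A)\in\mathfrak{spin}(\mathfrak m)\subset\mathcal C(\mathfrak m)$, and put $\widetilde{\mathrm{ad}}(X)=\widetilde{\mathrm{ad}(X)|_{\mathfrak m}}$ for $X\in\mathfrak h$. Spinor fields are smooth maps $\psi:G\to\Delta$ with $\psi(gh)=\widetilde{\mathrm{Ad}}(h^{-1})\cdot\psi(g)$ for $g\in G$, $h\in H$; for $X\in\mathfrak g$, $X(\psi)$ is the derivative along the left-invariant field $X$. For $t\in\mathbb R$ let $\Lambda^t(X)Y=t[X,Y]_{\mathfrak m}$ ($X,Y\in\mathfrak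 m$), defining the invariant metric connection $\nabla^t$, with $\nabla^t_X\psi=X(\psi)+\widetilde{\Lambda^t(X)}\cdot\psi$ on spinors and curvature $R^t(X,Y)=[\Lambda^t(X),\Lambda^t(Y)]-\Lambda^t([X,Y]_{\mathfrak m})-\mathrm{ad}([X,Y]_{\mathfrak h})$. For an orthonormal basis $Z_1,\dots,Z_n$ of $\mathfrak m$ and $Q$-dual bases $X_i,Y_i$ of $\mathfrak h$ let $$D^t\psi=\sum_i Z_i\cdot\nabla^t_{Z_i}\psi,\qquad \mathrm{Scal}^t=\sum_{i,j}\langle R^t(Z_j,Z_i)Z_i,Z_j\rangle,$$ $$\Omega_{\mathfrak g}\psi=-\sum_i Z_i^2(\psi)+\tilde C_{\mathfrak h}\cdot\psi,\qquad \tilde C_{\mathfrak h}=-\sum_i\widetilde{\mathrm{ad}}(X_i)\cdot\widetilde{\mathrm{ad}}(Y_i).$$ Let $\mathrm{Jac}_{\mathfrak m}(X,Y,Z)=[X,[Y,Z]_{\mathfrak m}]_{\mathfrak m}+[Y,[Z,X]_{\mathfrak m}]_{\mathfrak m}+[Z,[X,Y]_{\mathfrak m}]_{\mathfrak m}$ and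 $\mathrm{Jac}_{\mathfrak h}(X,Y,Z)=[X,[Y,Z]_{\mathfrak h}]+[Y,[Z,X]_{\mathfrak h}]+[Z,[X,Y]_{\mathfrak h}]$ for $X,Y,Z\in\mathfrak m$. *Claim.* Let $n=\dim\mathfrak m$ satisfy $n=3$ or $n\ge5$, and let $\psi$ be a spinor field. For $t=1/3$ the first-order term $\frac12(1-3t)\sum_{i,j,k}\langle[Z_i,Z_j]_{\mathfrak m},Z_k\rangle Z_i\cdot Z_j\cdot Z_k(\psi)$ and the degree-4 term $-\frac12\sum_{i<j<k<l}\langle Z_i,(\mathrm{Jac}_{\mathfrak h}+9t^2\mathrm{Jac}_{\mathfrak m})(Z_j,Z_k,Z_l)\rangle Z_i\cdot Z_j\cdot Z_k\cdot Z_l$ vanish, and $$(D^{1/3})^2\psi=\Omega_{\mathfrak g}\psi+\frac18\Big[\sum_{i,j}Q_{\mathfrak h}([Z_i,Z_j],[Z_i,Z_j])+\frac13\sum_{i,j}Q_{\mathfrak m}([Z_i,Z_j],[Z_i,Z_j])\Big]\psi$$ $$=\Omega_{\mathfrak g}\psi+\frac18\Big[\mathrm{Scal}^{1/3}+\frac19\sum_{i,j}Q_{\mathfrak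 m}([Z_i,Z_j],[Z_i,Z_j])\Big]\psi .$$ In particular, in the symmetric case $[\mathfrak m,\mathfrak m]\subset\mathfrak h$ one recovers Parthasarathy's formula $D^2\psi=\Omega_{\mathfrak g}\psi+\frac18\mathrm{Scal}\,\psi$ for the Dirac operator $D=D^{1/2}$ and the scalar curvature $\mathrm{Scal}=\mathrm{Scal}^{1/2}$ of the Levi-Civita connection. -/

import Mathlib

open scoped Manifold ContDiff

noncomputable section

namespace NaturallyReductive

section LieGroups

variable {E : Type*} [NormedAddCommGroup E] [NormedSpace ℝ E]
  {G : Type*} [TopologicalSpace G] [ChartedSpace E G] [Group G]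

/-- The adjoint representation of a Lie group: `Ad g` is the differential at the identity of the
conjugation `x ↦ g x g⁻¹`. -/
def Ad (g : G) (X : GroupLieAlgebra 𝓘(ℝ, E) G) : GroupLieAlgebra 𝓘(ℝ, E) G :=
  mfderiv 𝓘(ℝ, E) 𝓘(ℝ, E) (fun x : G => g * x * g⁻¹) 1 X

/-- `H` is a closed Lie subgroup of `G`: it is closed, and the inclusion of `H` (with the subspace
topology and its own manifold structure) into `G` is smooth with injective differential. -/
structure IsClosedLieSubgroup (E : Type*) [NormedAddCommGroup E] [NormedSpace ℝ E]
    {G : Type*} [TopologicalSpace G] [ChartedSpace E G] [Group G]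
    (F : Type*) [NormedAddCommGroup F] [NormedSpace ℝ F]
    (H : Subgroup G) [ChartedSpace F H] : Prop where
  isClosed : IsClosed (H : Set G)
  contMDiff_val : ContMDiff 𝓘(ℝ, F) 𝓘(ℝ, E) ∞ (Subtype.val : H → G)
  injective_mfderiv :
    Function.Injective (mfderiv 𝓘(ℝ, F) 𝓘(ℝ, E) (Subtype.val : H → G) 1)

/-- The Lie algebra `𝔥` of a Lie subgroup `H`, as a subspace of the Lie algebra `𝔤` of `G`: the
image of the tangent space of `H` at the identity under the differential of the inclusion. -/
def isotropyAlgebra (E : Type*) [NormedAddCommGroup E] [NormedSpace ℝ E]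
    {G : Type*} [TopologicalSpace G] [ChartedSpace E G] [Group G]
    (F : Type*) [NormedAddCommGroup F] [NormedSpace ℝ F]
    (H : Subgroup G) [ChartedSpace F H] : Submodule ℝ (GroupLieAlgebra 𝓘(ℝ, E) G) :=
  LinearMap.range
    (mfderiv 𝓘(ℝ, F) 𝓘(ℝ, E) (Subtype.val : H → G) 1 :
      GroupLieAlgebra 𝓘(ℝ, F) H →L[ℝ] GroupLieAlgebra 𝓘(ℝ, E) G).toLinearMap

/-- `X(ψ)`: the derivative of a vector valued function on `G` along the left invariant vector
field defined by `X ∈ 𝔤`. -/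
def leftDeriv {Δ : Type*} [NormedAddCommGroup Δ] [NormedSpace ℝ Δ]
    (X : GroupLieAlgebra 𝓘(ℝ, E) G) (ψ : G → Δ) (g : G) : Δ :=
  mfderiv 𝓘(ℝ, E) 𝓘(ℝ, Δ) ψ g (mulInvariantVectorField X g)

end LieGroups

/-- A reductive decomposition `𝔤 = 𝔥 ⊕ 𝔪` of the homogeneous space `M = G/H` together with a
`G`-invariant Riemannian metric on `M` (that is, an `Ad(H)`-invariant inner product on `𝔪`)
which is naturally reductive with respect to `G`. -/
structure Space (E : Type*) [NormedAddCommGroup E] [NormedSpace ℝ E]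
    {G : Type*} [TopologicalSpace G] [ChartedSpace E G] [Group G]
    (F : Type*) [NormedAddCommGroup F] [NormedSpace ℝ F]
    (H : Subgroup G) [ChartedSpace F H] where
  /-- the reductive complement -/
  m : Submodule ℝ (GroupLieAlgebra 𝓘(ℝ, E) G)
  isCompl : IsCompl (isotropyAlgebra E F H) m
  Ad_mem : ∀ h ∈ H, ∀ X ∈ m, Ad h X ∈ m
  /-- the inner product on the reductive complement -/
  inner : LinearMap.BilinForm ℝ m
  inner_symm : ∀ X Y, inner X Y = inner Y X
  inner_pos : ∀ X, X ≠ 0 → 0 < inner X X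
  inner_Ad : ∀ (h : G) (hh : h ∈ H) (X Y : m),
    inner ⟨Ad h X, Ad_mem h hh X X.2⟩ ⟨Ad h Y, Ad_mem h hh Y Y.2⟩ = inner X Y
  inner_bracket : ∀ X Y Z : m,
    inner (m.projectionOnto _ isCompl.symm ⁅X.1, Y.1⁆) Z
      + inner Y (m.projectionOnto _ isCompl.symm ⁅X.1, Z.1⁆) = 0

namespace Space

variable {E : Type*} [NormedAddCommGroup E] [NormedSpace ℝ E]
  {G : Type*} [TopologicalSpace G] [ChartedSpace E G] [Group G]
  {F : Type*} [NormedAddCommGroup F] [NormedSpace ℝ F]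
  {H : Subgroup G} [ChartedSpace F H]
  (M : Space E F H)

/-- The projection of `𝔤` onto `𝔪` along `𝔥`. -/
def toM (X : GroupLieAlgebra 𝓘(ℝ, E) G) : M.m := M.m.projectionOnto _ M.isCompl.symm X

/-- The projection of `𝔤` onto `𝔥` along `𝔪`. -/
def toH (X : GroupLieAlgebra 𝓘(ℝ, E) G) : isotropyAlgebra E F H :=
  (isotropyAlgebra E F H).projectionOnto _ M.isCompl X

/-- `[X, Y]_𝔪`. -/
def bracketM (X Y : M.m) : M.m := M.toM ⁅X.1, Y.1⁆

/-- `[X, Y]_𝔥`. -/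
def bracketH (X Y : M.m) : isotropyAlgebra E F H := M.toH ⁅X.1, Y.1⁆

/-- The isotropy representation of `H` on `𝔪`. -/
def isotropyRep (h : H) (X : M.m) : M.m := ⟨Ad h.1 X.1, M.Ad_mem h.1 h.2 X.1 X.2⟩

/-- The differential `ad : 𝔥 → so(𝔪)` of the isotropy representation. -/
def adM (A : isotropyAlgebra E F H) (X : M.m) : M.m := M.toM ⁅A.1, X.1⁆

/-- `Q` is an `Ad(G)`-invariant extension of the inner product to `𝔤`: a symmetric non degenerate
`Ad(G)`-invariant bilinear form with `Q(𝔥, 𝔪) = 0` that restricts to the inner product on `𝔪`. -/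
structure IsInvariantExtension (Q : LinearMap.BilinForm ℝ (GroupLieAlgebra 𝓘(ℝ, E) G)) :
    Prop where
  symm : ∀ X Y, Q X Y = Q Y X
  nondegenerate : ∀ X, (∀ Y, Q X Y = 0) → X = 0
  invariant : ∀ (g : G) (X Y), Q (Ad g X) (Ad g Y) = Q X Y
  orthogonal : ∀ X ∈ isotropyAlgebra E F H, ∀ Y ∈ M.m, Q X Y = 0
  restrict : ∀ X Y : M.m, Q X.1 Y.1 = M.inner X Y

/-! ### The family of connections -/

/-- The map `Λ^t : 𝔪 → so(𝔪)`, `Λ^t(X) Y = t [X, Y]_𝔪`, that defines the invariant metric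
connection `∇^t`. -/
def connectionMap (t : ℝ) (X Y : M.m) : M.m := t • M.bracketM X Y

/-- The curvature tensor of `∇^t`,
`R(X, Y) = [Λ(X), Λ(Y)] - Λ([X, Y]_𝔪) - ad([X, Y]_𝔥)`. -/
def curvature (t : ℝ) (X Y V : M.m) : M.m :=
  M.connectionMap t X (M.connectionMap t Y V) - M.connectionMap t Y (M.connectionMap t X V)
    - M.connectionMap t (M.bracketM X Y) V - M.adM (M.bracketH X Y) V

/-- The Ricci tensor of `∇^t`, computed in the orthonormal basis `Z`. -/
def ricci {n : ℕ} (Z : Fin n → M.m) (t : ℝ) (X Y : M.m) : ℝ :=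
  ∑ i, M.inner (M.curvature t X (Z i) (Z i)) Y

/-- The scalar curvature of `∇^t`, computed in the orthonormal basis `Z`. -/
def scal {n : ℕ} (Z : Fin n → M.m) (t : ℝ) : ℝ := ∑ j, M.ricci Z t (Z j) (Z j)

/-! ### Clifford algebra, spin group and spin structures -/

/-- The quadratic form `X ↦ -⟨X, X⟩`. -/
def cliffordForm : QuadraticForm ℝ M.m := -(LinearMap.BilinMap.toQuadraticMap M.inner)

/-- The Clifford algebra of `𝔪`, with relations `X · Y + Y · X = -2 ⟨X, Y⟩`. -/
abbrev Cl : Type _ := CliffordAlgebra M.cliffordForm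

/-- A vector of `𝔪` as an element of the Clifford algebra. -/
abbrev vec (X : M.m) : M.Cl := CliffordAlgebra.ι M.cliffordForm X

/-- The Lie algebra `spin(𝔪)` inside the Clifford algebra: the elements of second degree, that is,
the span of all `v · w - w · v`. -/
def spinAlgebra : Submodule ℝ M.Cl :=
  Submodule.span ℝ {a | ∃ v w : M.m, a = M.vec v * M.vec w - M.vec w * M.vec v}

/-- The lift of `A ∈ so(𝔪)` to `spin(𝔪)`, the inverse image of `A` under the isomorphism
`dλ : spin(𝔪) → so(𝔪)`, `dλ(a) v = a · v - v · a`, that is, under the differential of the spin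
covering `λ(a) v = a · v · a⁻¹`. -/
def spinLift (A : M.m → M.m) : M.Cl :=
  (Function.invFun
    (fun (a : M.spinAlgebra) (v : M.m) => (a : M.Cl) * M.vec v - M.vec v * (a : M.Cl))
    (fun v => M.vec (A v)) : M.spinAlgebra)

/-- A homogeneous spin structure on `M`: a smooth homomorphism `H → Spin(𝔪)` that lifts the
isotropy representation through the spin covering. Smoothness as a map into the (finite
dimensional) Clifford algebra is expressed through all linear functionals. -/
structure SpinStructure where
  /-- the lift of the isotropy representation -/
  lift : H →* spinGroup M.cliffordForm
  covers : ∀ (h : H) (v : M.m),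
    (lift h : M.Cl) * M.vec v * ((lift h)⁻¹ : spinGroup M.cliffordForm) =
      M.vec (M.isotropyRep h v)
  smooth : ∀ f : M.Cl →ₗ[ℝ] ℝ,
    ContMDiff 𝓘(ℝ, F) 𝓘(ℝ, ℝ) ∞ (fun h : H => f (lift h : M.Cl))

/-- The lift of `ad : 𝔥 → so(𝔪)` to `spin(𝔪)`. -/
def adLift (A : isotropyAlgebra E F H) : M.Cl := M.spinLift (M.adM A)

/-- The lift `-∑ ãd(X_i) · ãd(Y_i)` of the Casimir element of `𝔥` to the Clifford algebra, where
`X`, `Y` are dual bases of `𝔥`. -/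
def casimirH {r : ℕ} (X Y : Fin r → isotropyAlgebra E F H) : M.Cl :=
  -∑ i, M.adLift (X i) * M.adLift (Y i)

/-! ### Spinor fields and operators -/

section Spinors

variable {Δ : Type*} [NormedAddCommGroup Δ] [NormedSpace ℂ Δ]

/-- `Δ`, with Clifford multiplication `c`, is a spin module: an irreducible complex module over
the Clifford algebra of `𝔪`. -/
structure IsSpinModule (c : M.Cl →ₐ[ℝ] Module.End ℂ Δ) : Prop where
  nontrivial : Nontrivial Δ
  irreducible : ∀ W : Submodule ℂ Δ, (∀ a, ∀ w ∈ W, c a w ∈ W) → W = ⊥ ∨ W = ⊤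

/-- Smooth sections of the spinor bundle `G ×_H Δ`, as smooth functions `ψ : G → Δ` with
`ψ(g h) = κ(Ãd(h⁻¹)) ψ(g)`, where `κ` is the restriction of `c` to the spin group. -/
structure IsSpinorField (S : M.SpinStructure) (c : M.Cl →ₐ[ℝ] Module.End ℂ Δ) (ψ : G → Δ) :
    Prop where
  contMDiff : ContMDiff 𝓘(ℝ, E) 𝓘(ℝ, Δ) ∞ ψ
  equivariant : ∀ (g : G) (h : H), ψ (g * h) = c (S.lift h⁻¹ : M.Cl) (ψ g)

variable (c : M.Cl →ₐ[ℝ] Module.End ℂ Δ)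

/-- The covariant derivative `∇^t_X ψ = X(ψ) + Λ̃^t(X) · ψ` on spinors. -/
def covDeriv (t : ℝ) (X : M.m) (ψ : G → Δ) (g : G) : Δ :=
  leftDeriv X.1 ψ g + c (M.spinLift (M.connectionMap t X)) (ψ g)

/-- The Dirac operator `D^t ψ = ∑ Z_i · ∇^t_{Z_i} ψ`, for an orthonormal basis `Z` of `𝔪`. -/
def dirac {n : ℕ} (Z : Fin n → M.m) (t : ℝ) (ψ : G → Δ) (g : G) : Δ :=
  ∑ i, c (M.vec (Z i)) (M.covDeriv c t (Z i) ψ g)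

/-- The Casimir operator of `𝔤` on spinors, `Ω ψ = -∑ Z_i²(ψ) + C̃_𝔥 · ψ`, for an orthonormal
basis `Z` of `𝔪` and dual bases `X`, `Y` of `𝔥`. -/
def casimirG {n r : ℕ} (Z : Fin n → M.m) (X Y : Fin r → isotropyAlgebra E F H)
    (ψ : G → Δ) (g : G) : Δ :=
  -∑ i, leftDeriv (Z i).1 (leftDeriv (Z i).1 ψ) g + c (M.casimirH X Y) (ψ g)

/-- The first order term
`(1/2) (1 - 3t) ∑ ⟨[Z_i, Z_j]_𝔪, Z_k⟩ Z_i · Z_j · Z_k(ψ)` of the square of `D^t`. -/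
def firstOrderTerm {n : ℕ} (Z : Fin n → M.m) (t : ℝ) (ψ : G → Δ) (g : G) : Δ :=
  ((1 / 2 : ℝ) * (1 - 3 * t)) • ∑ i, ∑ j, ∑ k,
    M.inner (M.bracketM (Z i) (Z j)) (Z k) •
      c (M.vec (Z i) * M.vec (Z j)) (leftDeriv (Z k).1 ψ g)

end Spinors

/-- `Jac_𝔪(X, Y, Z)`. -/
def jacM (X Y Z : M.m) : M.m :=
  M.bracketM X (M.bracketM Y Z) + M.bracketM Y (M.bracketM Z X) + M.bracketM Z (M.bracketM X Y)

/-- `Jac_𝔥(X, Y, Z) = [X, [Y, Z]_𝔥] + [Y, [Z, X]_𝔥] + [Z, [X, Y]_𝔥]`, whose summands lie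
in `𝔪`. -/
def jacH (X Y Z : M.m) : M.m :=
  M.toM (⁅X.1, (M.bracketH Y Z).1⁆ + ⁅Y.1, (M.bracketH Z X).1⁆ + ⁅Z.1, (M.bracketH X Y).1⁆)

/-- The degree four term
`-(1/2) ∑_{i<j<k<l} ⟨Z_i, (Jac_𝔥 + 9 t² Jac_𝔪)(Z_j, Z_k, Z_l)⟩ Z_i · Z_j · Z_k · Z_l`
of the square of `D^t`. -/
def degreeFourTerm {n : ℕ} (Z : Fin n → M.m) (t : ℝ) : M.Cl :=
  (-(1 / 2) : ℝ) • ∑ i, ∑ j, ∑ k, ∑ l,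
    if i < j ∧ j < k ∧ k < l then
      M.inner (Z i) (M.jacH (Z j) (Z k) (Z l) + (9 * t ^ 2) • M.jacM (Z j) (Z k) (Z l)) •
        (M.vec (Z i) * M.vec (Z j) * M.vec (Z k) * M.vec (Z l))
    else 0

/-- `∑_{i,j} Q_𝔥([Z_i, Z_j], [Z_i, Z_j])`. -/
def sumQH (Q : LinearMap.BilinForm ℝ (GroupLieAlgebra 𝓘(ℝ, E) G)) {n : ℕ} (Z : Fin n → M.m) : ℝ :=
  ∑ i, ∑ j, Q (M.bracketH (Z i) (Z j)).1 (M.bracketH (Z i) (Z j)).1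

/-- `∑_{i,j} Q_𝔪([Z_i, Z_j], [Z_i, Z_j])`. -/
def sumQM (Q : LinearMap.BilinForm ℝ (GroupLieAlgebra 𝓘(ℝ, E) G)) {n : ℕ} (Z : Fin n → M.m) : ℝ :=
  ∑ i, ∑ j, Q (M.bracketM (Z i) (Z j)).1 (M.bracketM (Z i) (Z j)).1

end Space

end NaturallyReductive

end

/-!
The theorem is a computation in the Clifford algebra of `𝔪`, once every operator is written through
left-invariant derivatives. Put `eᵢ = Zᵢ`, `Tᵢⱼₖ = ⟨[Zᵢ, Zⱼ]_𝔪, Zₖ⟩`, which is totally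
antisymmetric, `𝒯 = ∑ Tᵢⱼₖ eᵢ eⱼ eₖ` and `Rᵢⱼₖₗ = Q([Zᵢ, Zⱼ]_𝔥, [Zₖ, Zₗ]_𝔥)`. A skew map `A` lifts
to `¼ ∑ ⟨A Zⱼ, Zₖ⟩ eⱼ eₖ`, whence `D^t = ∑ eᵢ ∂ᵢ + (t/4) 𝒯` (`Space.dirac_eq`), and at `t = 1/3`
the cubic term is `𝒯 / 12`.

In `(D^{1/3})²` the second-order part is `∑ eᵢ eⱼ ∂ᵢ ∂ⱼ = -∑ ∂ᵢ² + ½ ∑ eᵢ eⱼ ∂_{[Zᵢ, Zⱼ]}`, because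
left-invariant derivatives represent the Lie algebra (`leftDeriv_comm`). The `𝔪`-component of the
bracket gives the first-order terms `½ ∑ₖ σₖ ∂ₖ` with `σₖ = ∑ Tₖᵢⱼ eᵢ eⱼ`. They cancel against
`(1/12) ∑ (eₖ 𝒯 + 𝒯 eₖ) ∂ₖ`, since `eₖ 𝒯 + 𝒯 eₖ = -6 σₖ`
(`CliffordRelations.anticommutator_cubicSum`). The `𝔥`-component acts algebraically: equivariance
of the spinor field gives `∂_A ψ = -ãd(A) ψ` for `A ∈ 𝔥` (`Space.leftDeriv_isotropy`), so it
contributes `-⅛ ∑ Rᵢⱼₖₗ eᵢ eⱼ eₖ eₗ`.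

It remains to compare this with `C̃_𝔥 = -(1/16) ∑ Rᵢⱼₖₗ eᵢ eⱼ eₖ eₗ` (`Space.casimirH_eq`) and with
`𝒯² / 144`. Here the Jacobi identity enters: `Q([Zᵢ, Zⱼ], [Zₖ, Zₗ])` satisfies the first Bianchi
identity, so its Clifford element is a scalar, as in Lichnerowicz's formula
(`CliffordRelations.quadSum_of_bianchi`). This turns the part of degree four of `𝒯²` into
`9 ∑ Rᵢⱼₖₗ eᵢ eⱼ eₖ eₗ` plus scalars (`Space.cubicSum_torsionTensor_mul_self`). All terms of degree
four then match those of `C̃_𝔥`, and the scalars are those of the formula. The version with the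
scalar curvature follows from `Scal^t = ∑ Q_𝔥 + (t - t²) ∑ Q_𝔪` (`Space.scal_eq`).

Two analytic facts are needed. The bracket of a Lie group, defined through invariant vector fields,
is the antisymmetrized mixed second derivative of the multiplication at the identity
(`bracket_eq_mixed`), from which `leftDeriv_comm` and `dAd = ad` (`exists_hasChartDerivAt_Ad`)
follow. The differential of a spin structure is `ãd`: it is even, skew for the canonical involution,
and has the commutators with vectors prescribed by the covering property, and these three properties
determine an element of the Clifford algebra (`Space.eq_skewElement`).
-/

open scoped Manifold ContDiff

noncomputable section

namespace NaturallyReductive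

/-! ### Clifford relations and sums over indices -/

section Relations

variable {A : Type*} [Ring A] [Algebra ℝ A] {n : ℕ} {e : Fin n → A}

theorem sum_cyclic {B : Type*} [AddCommMonoid B] (f : Fin n → Fin n → Fin n → B) :
    ∑ i, ∑ j, ∑ k, f j k i = ∑ i, ∑ j, ∑ k, f i j k := by
  rw [Finset.sum_comm]
  exact Finset.sum_congr rfl fun j _ => Finset.sum_comm

/-- The relations `eᵢ eⱼ + eⱼ eᵢ = -2 δᵢⱼ` of the Clifford algebra of an orthonormal basis. -/
def CliffordRelations (e : Fin n → A) : Prop :=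
  ∀ i j, e i * e j = -(e j * e i) - if i = j then 2 else 0

theorem CliffordRelations.mul_self (he : CliffordRelations e) (i : Fin n) :
    e i * e i = -1 := by
  have h := he i i
  rw [if_pos rfl, eq_sub_iff_add_eq, eq_neg_iff_add_eq_zero] at h
  have h2 : (2 : ℝ) • (e i * e i + 1) = 0 := by
    rw [two_smul, ← h, ← one_add_one_eq_two]; abel
  rw [eq_neg_iff_add_eq_zero]
  exact (smul_eq_zero_iff_right two_ne_zero).1 h2

theorem CliffordRelations.sum_symm (he : CliffordRelations e) {r : Fin n → Fin n → ℝ}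
    (hr : ∀ i j, r i j = r j i) :
    ∑ i, ∑ j, r i j • (e i * e j) = -((∑ i, r i i) • 1) := by
  have h1 : ∑ i, ∑ j, r i j • (e i * e j) = ∑ i, ∑ j, r i j • (e j * e i) := by
    rw [Finset.sum_comm]
    simp_rw [hr]
  have h2 : ∑ i, ∑ j, r i j • (e i * e j)
      = -(∑ i, ∑ j, r i j • (e j * e i)) - (2 : ℝ) • ((∑ i, r i i) • 1) := by
    simp_rw [fun i j => congrArg (r i j • ·) (he i j), smul_sub, smul_neg, smul_ite, smul_zero,
      Finset.sum_sub_distrib, Finset.sum_neg_distrib, Finset.sum_ite_eq, Finset.mem_univ, if_true]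
    rw [Finset.sum_smul, Finset.smul_sum]
    congr 1
    refine Finset.sum_congr rfl fun i _ => ?_
    rw [smul_smul, mul_comm, ← smul_smul, two_smul ℝ (1 : A), one_add_one_eq_two]
  rw [← h1] at h2
  have h3 : (2 : ℝ) • (∑ i, ∑ j, r i j • (e i * e j) + (∑ i, r i i) • (1 : A)) = 0 := by
    rw [smul_add, two_smul]
    nth_rewrite 1 [h2]
    abel
  rw [eq_neg_iff_add_eq_zero]
  exact (smul_eq_zero_iff_right two_ne_zero).1 h3

/-- The Clifford element `∑ R i j k l • e i e j e k e l` of a tensor of degree four. -/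
def quadSum (e : Fin n → A) (R : Fin n → Fin n → Fin n → Fin n → ℝ) : A :=
  ∑ i, ∑ j, ∑ k, ∑ l, R i j k l • (e i * e j * e k * e l)

/-- A tensor with the algebraic symmetries of a curvature tensor, apart from the first Bianchi
identity. -/
structure IsCurvatureLike (R : Fin n → Fin n → Fin n → Fin n → ℝ) : Prop where
  antisymm : ∀ i j k l, R j i k l = -R i j k l
  pair_symm : ∀ i j k l, R k l i j = R i j k l

theorem IsCurvatureLike.antisymm' {R : Fin n → Fin n → Fin n → Fin n → ℝ}
    (hR : IsCurvatureLike R) (i j k l : Fin n) : R i j l k = -R i j k l := by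
  rw [← hR.pair_symm, hR.antisymm, hR.pair_symm]

theorem IsCurvatureLike.ricci_symm {R : Fin n → Fin n → Fin n → Fin n → ℝ}
    (hR : IsCurvatureLike R) (j l : Fin n) : ∑ i, R i j i l = ∑ i, R i l i j :=
  Finset.sum_congr rfl fun _ _ => hR.pair_symm _ _ _ _

/-- The Ricci contraction of a curvature-like tensor contributes only its trace. -/
theorem CliffordRelations.sum_ricci (he : CliffordRelations e)
    {R : Fin n → Fin n → Fin n → Fin n → ℝ} (hR : IsCurvatureLike R) :
    ∑ i, ∑ j, ∑ l, R i j i l • (e j * e l) = -((∑ i, ∑ j, R i j i j) • 1) := by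
  have h := he.sum_symm (r := fun j l => ∑ i, R i j i l) hR.ricci_symm
  rw [Finset.sum_comm (f := fun i j => R i j i j), ← h, Finset.sum_comm]
  refine Finset.sum_congr rfl fun j _ => ?_
  rw [Finset.sum_comm]
  simp_rw [Finset.sum_smul]

theorem CliffordRelations.sum_ricci_middle (he : CliffordRelations e)
    {R : Fin n → Fin n → Fin n → Fin n → ℝ} (hR : IsCurvatureLike R) :
    ∑ i, ∑ j, ∑ l, R i j j l • (e i * e l) = (∑ i, ∑ j, R i j i j) • 1 := by
  rw [Finset.sum_comm, ← neg_inj, ← he.sum_ricci hR]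
  simp_rw [← Finset.sum_neg_distrib, ← neg_smul]
  exact Finset.sum_congr rfl fun j _ => Finset.sum_congr rfl fun i _ =>
    Finset.sum_congr rfl fun l _ => by rw [hR.antisymm j i, neg_neg]

theorem CliffordRelations.sum_ricci_right (he : CliffordRelations e)
    {R : Fin n → Fin n → Fin n → Fin n → ℝ} (hR : IsCurvatureLike R) :
    ∑ i, ∑ j, ∑ k, R i j k j • (e i * e k) = -((∑ i, ∑ j, R i j i j) • 1) := by
  rw [← he.sum_ricci_middle hR]
  simp_rw [← Finset.sum_neg_distrib, ← neg_smul]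
  exact Finset.sum_congr rfl fun j _ => Finset.sum_congr rfl fun i _ =>
    Finset.sum_congr rfl fun l _ => by rw [hR.antisymm']

/-- For a curvature-like tensor with the first Bianchi identity, only the scalar part of
`∑ R i j k l • e i e j e k e l` survives: up to contractions the product does not change when its
first three factors are permuted cyclically, so three times the sum is a cyclic sum, which is
zero. -/
theorem CliffordRelations.quadSum_of_bianchi (he : CliffordRelations e)
    {R : Fin n → Fin n → Fin n → Fin n → ℝ} (hR : IsCurvatureLike R)
    (hB : ∀ i j k l, R i j k l + R j k i l + R k i j l = 0) :
    quadSum e R = -((2 * ∑ i, ∑ j, R i j i j) • 1) := by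
  have h0 : ∑ i, ∑ j, ∑ k, ∑ l, (R i j k l + R j k i l + R k i j l) •
      (e i * e j * e k * e l) = 0 := by simp [hB]
  have hr1 : ∑ i, ∑ j, ∑ k, ∑ l, R j k i l • (e i * e j * e k * e l)
      = ∑ i, ∑ j, ∑ k, ∑ l, R i j k l • (e k * e i * e j * e l) :=
    sum_cyclic (fun i j k => ∑ l, R i j k l • (e k * e i * e j * e l))
  have hr2 : ∑ i, ∑ j, ∑ k, ∑ l, R k i j l • (e i * e j * e k * e l)
      = ∑ i, ∑ j, ∑ k, ∑ l, R i j k l • (e j * e k * e i * e l) :=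
    (sum_cyclic (fun i j k => ∑ l, R k i j l • (e i * e j * e k * e l))).symm
  simp_rw [add_smul, Finset.sum_add_distrib] at h0
  rw [hr1, hr2] at h0
  have p1 : ∀ i j k l, R i j k l • (e k * e i * e j * e l) = R i j k l • (e i * e j * e k * e l)
      + (if k = j then (2 * R i j k l) • (e i * e l) else 0)
      - (if k = i then (2 * R i j k l) • (e j * e l) else 0) := by
    intro i j k l
    have : e k * e i * e j * e l = e i * e j * e k * e l + (if k = j then 2 else 0) * (e i * e l)
        - (if k = i then 2 else 0) * (e j * e l) := by
      rw [he k i, sub_mul, sub_mul, neg_mul, mul_assoc (e i) (e k) (e j), he k j]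
      split_ifs <;> noncomm_ring
    rw [this]
    split_ifs <;> simp [smul_add, smul_sub, two_mul, add_smul]
  have p2 : ∀ i j k l, R i j k l • (e j * e k * e i * e l) = R i j k l • (e i * e j * e k * e l)
      + (if i = j then (2 * R i j k l) • (e k * e l) else 0)
      - (if k = i then (2 * R i j k l) • (e j * e l) else 0) := by
    intro i j k l
    have : e j * e k * e i * e l = e i * e j * e k * e l + (if i = j then 2 else 0) * (e k * e l)
        - (if k = i then 2 else 0) * (e j * e l) := by
      rw [he i j, mul_assoc (e j) (e k) (e i), he k i]
      split_ifs <;> noncomm_ring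
    rw [this]
    split_ifs <;> simp [smul_add, smul_sub, two_mul, add_smul]
  simp only [p1, p2, Finset.sum_add_distrib, Finset.sum_sub_distrib] at h0
  have d1 : ∑ i, ∑ j, ∑ k, ∑ l, (if k = j then (2 * R i j k l) • (e i * e l) else 0)
      = (2 * ∑ i, ∑ j, R i j i j) • (1 : A) := by
    simp_rw [Finset.sum_ite_irrel, Finset.sum_const_zero, Finset.sum_ite_eq', Finset.mem_univ,
      if_true, mul_smul, ← Finset.smul_sum]
    rw [he.sum_ricci_middle hR]
  have d2 : ∑ i, ∑ j, ∑ k, ∑ l, (if k = i then (2 * R i j k l) • (e j * e l) else 0)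
      = -((2 * ∑ i, ∑ j, R i j i j) • (1 : A)) := by
    simp_rw [Finset.sum_ite_irrel, Finset.sum_const_zero, Finset.sum_ite_eq', Finset.mem_univ,
      if_true, mul_smul, ← Finset.smul_sum]
    rw [he.sum_ricci hR, smul_neg]
  have d3 : ∑ i, ∑ j, ∑ k, ∑ l, (if i = j then (2 * R i j k l) • (e k * e l) else 0) = 0 := by
    have hz : ∀ i k l, R i i k l = 0 := fun i k l => by
      have := hR.antisymm i i k l; linarith
    refine Finset.sum_eq_zero fun i _ => Finset.sum_eq_zero fun j _ =>
      Finset.sum_eq_zero fun k _ => Finset.sum_eq_zero fun l _ => ?_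
    split_ifs with h
    · subst h; simp [hz]
    · rfl
  rw [d1, d2, d3] at h0
  rw [eq_neg_iff_add_eq_zero]
  have h3 : (3 : ℝ) • (quadSum e R + (2 * ∑ i, ∑ j, R i j i j) • (1 : A)) = 0 := by
    rw [← h0, quadSum]
    module
  exact (smul_eq_zero_iff_right three_ne_zero).1 h3

/-- The tensor `∑ₚ T i j p * T k l p`; for structure constants `T` it consists of the inner products
of brackets. -/
def wedgeSquare (T : Fin n → Fin n → Fin n → ℝ) (i j k l : Fin n) : ℝ :=
  ∑ p, T i j p * T k l p

theorem isCurvatureLike_wedgeSquare {T : Fin n → Fin n → Fin n → ℝ}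
    (h12 : ∀ i j k, T j i k = -T i j k) : IsCurvatureLike (wedgeSquare T) where
  antisymm i j k l := by simp [wedgeSquare, h12 i j]
  pair_symm i j k l := by simp [wedgeSquare, mul_comm]

/-- The contraction `∑ T p i j • e i e j` of a tensor of degree three with one vector. -/
def slice (e : Fin n → A) (T : Fin n → Fin n → Fin n → ℝ) (p : Fin n) : A :=
  ∑ i, ∑ j, T p i j • (e i * e j)

/-- The Clifford element `∑ T i j k • e i e j e k` of a tensor of degree three. -/
def cubicSum (e : Fin n → A) (T : Fin n → Fin n → Fin n → ℝ) : A :=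
  ∑ i, ∑ j, ∑ k, T i j k • (e i * e j * e k)

theorem cubicSum_eq (e : Fin n → A) (T : Fin n → Fin n → Fin n → ℝ) :
    cubicSum e T = ∑ p, e p * slice e T p := by
  simp_rw [cubicSum, slice, Finset.mul_sum, mul_smul_comm, mul_assoc]

variable {T : Fin n → Fin n → Fin n → ℝ}

/-- An element of degree two acts on vectors through commutators. -/
theorem CliffordRelations.commutator_degree_two (he : CliffordRelations e)
    {a : Fin n → Fin n → ℝ} (ha : ∀ i j, a j i = -a i j) (q : Fin n) :
    (∑ i, ∑ j, a i j • (e i * e j)) * e q - e q * ∑ i, ∑ j, a i j • (e i * e j)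
      = (4 : ℝ) • ∑ k, a q k • e k := by
  have h : ∀ i j, a i j • (e i * e j) * e q - e q * a i j • (e i * e j)
      = (if i = q then (2 * a i j) • e j else 0) - (if j = q then (2 * a i j) • e i else 0) := by
    intro i j
    have : e i * e j * e q - e q * (e i * e j)
        = (if i = q then 2 else 0) * e j - (if j = q then 2 else 0) * e i := by
      have hq := he q i
      simp only [@eq_comm _ q i] at hq
      rw [mul_assoc, he j q, ← mul_assoc (e q), hq, mul_sub]
      split_ifs <;> noncomm_ring
    rw [smul_mul_assoc, mul_smul_comm, ← smul_sub, this]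
    split_ifs <;> simp [smul_sub, two_mul, add_smul]
  simp_rw [Finset.sum_mul, Finset.mul_sum, ← Finset.sum_sub_distrib, h, Finset.sum_sub_distrib]
  simp_rw [Finset.sum_ite_irrel, Finset.sum_const_zero, Finset.sum_ite_eq', Finset.mem_univ,
    if_true]
  rw [← Finset.sum_sub_distrib, Finset.smul_sum]
  refine Finset.sum_congr rfl fun k _ => ?_
  rw [ha q k]
  module

theorem CliffordRelations.slice_mul (he : CliffordRelations e)
    (h23 : ∀ i j k, T i k j = -T i j k) (p q : Fin n) :
    slice e T p * e q = e q * slice e T p + (4 : ℝ) • ∑ k, T p q k • e k := by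
  rw [← he.commutator_degree_two (a := T p) (h23 p) q, slice]
  abel

/-- Anticommuting with a vector contracts an element of degree three. -/
theorem CliffordRelations.anticommutator_cubicSum (he : CliffordRelations e)
    (h12 : ∀ i j k, T j i k = -T i j k) (h23 : ∀ i j k, T i k j = -T i j k) (q : Fin n) :
    e q * cubicSum e T + cubicSum e T * e q = -((6 : ℝ) • slice e T q) := by
  have hs := fun p => he.slice_mul h23 p q
  have h : ∀ p, e q * (e p * slice e T p) + e p * slice e T p * e q
      = (4 : ℝ) • (∑ k, T p q k • (e p * e k)) - if q = p then 2 * slice e T p else 0 := by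
    intro p
    rw [mul_assoc (e p), hs, mul_add, ← mul_assoc, ← mul_assoc, he q p, mul_smul_comm,
      Finset.mul_sum]
    simp_rw [mul_smul_comm]
    split_ifs <;> noncomm_ring
  rw [cubicSum_eq, Finset.mul_sum, Finset.sum_mul, ← Finset.sum_add_distrib]
  simp_rw [h, Finset.sum_sub_distrib, Finset.sum_ite_eq, Finset.mem_univ, if_true]
  have h2 : ∑ p, (4 : ℝ) • (∑ k, T p q k • (e p * e k)) = -((4 : ℝ) • slice e T q) := by
    simp_rw [slice, ← Finset.smul_sum, h12 q, neg_smul, Finset.sum_neg_distrib, smul_neg]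
  rw [h2, two_mul]
  module

/-- Elements of degree two are closed under commutators. -/
theorem CliffordRelations.slice_commutator (he : CliffordRelations e)
    (h23 : ∀ i j k, T i k j = -T i j k) (p q : Fin n) :
    slice e T p * slice e T q - slice e T q * slice e T p
      = (4 : ℝ) • ∑ k, ∑ l, wedgeSquare T q k p l • (e l * e k - e k * e l) := by
  have h : ∀ j k, slice e T p * (T q j k • (e j * e k)) - T q j k • (e j * e k) * slice e T p
      = (4 : ℝ) • ∑ l, ((T q j k * T p j l) • (e l * e k) + (T q j k * T p k l) • (e j * e l)) := by
    intro j k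
    have : slice e T p * (e j * e k) - e j * e k * slice e T p
        = (4 : ℝ) • (∑ l, T p j l • e l) * e k + e j * (4 : ℝ) • ∑ l, T p k l • e l := by
      rw [← mul_assoc, he.slice_mul h23, add_mul, mul_assoc, he.slice_mul h23]
      noncomm_ring
    rw [mul_smul_comm, smul_mul_assoc, ← smul_sub, this, smul_mul_assoc, mul_smul_comm, ← smul_add,
      smul_comm, Finset.sum_mul, Finset.mul_sum, ← Finset.sum_add_distrib, Finset.smul_sum]
    simp_rw [smul_mul_assoc, mul_smul_comm, smul_add, smul_smul]
  have h1 : ∑ j, ∑ k, ∑ l, (T q j k * T p j l) • (e l * e k)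
      = ∑ k, ∑ l, wedgeSquare T q k p l • (e l * e k) := by
    rw [sum_cyclic (fun k l j => (T q j k * T p j l) • (e l * e k))]
    simp_rw [wedgeSquare, Finset.sum_smul]
    exact Finset.sum_congr rfl fun k _ => Finset.sum_congr rfl fun l _ => Finset.sum_congr rfl
      fun j _ => by rw [h23 q j k, h23 p j l, neg_mul_neg]
  have h2 : ∑ j, ∑ k, ∑ l, (T q j k * T p k l) • (e j * e l)
      = -∑ k, ∑ l, wedgeSquare T q k p l • (e k * e l) := by
    simp_rw [wedgeSquare, Finset.sum_smul, ← Finset.sum_neg_distrib]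
    refine Finset.sum_congr rfl fun k _ => ?_
    rw [Finset.sum_comm]
    exact Finset.sum_congr rfl fun l _ => Finset.sum_congr rfl
      fun j _ => by rw [h23 p l j, mul_neg, neg_smul]
  conv_lhs => rw [slice.eq_1 e T q]
  simp_rw [Finset.mul_sum, Finset.sum_mul, ← Finset.sum_sub_distrib, h, ← Finset.smul_sum,
    Finset.sum_add_distrib, h1, h2, smul_sub, Finset.sum_sub_distrib, sub_eq_add_neg]

theorem sum_slice_mul_self : ∑ p, slice e T p * slice e T p =
    ∑ i, ∑ j, ∑ k, ∑ l, (∑ p, T p i j * T p k l) • (e i * e j * e k * e l) := by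
  simp_rw [slice, Finset.sum_mul, Finset.mul_sum, Finset.sum_smul, smul_mul_assoc, mul_smul_comm,
    smul_smul, ← mul_assoc]
  rw [Finset.sum_comm]
  refine Finset.sum_congr rfl fun i _ => ?_
  rw [Finset.sum_comm]
  refine Finset.sum_congr rfl fun j _ => ?_
  rw [Finset.sum_comm]
  refine Finset.sum_congr rfl fun k _ => ?_
  rw [Finset.sum_comm]

/-- The terms of degree four that arise from commutators in the square of an element of degree
three. -/
theorem CliffordRelations.sum_reordered (he : CliffordRelations e)
    {R : Fin n → Fin n → Fin n → Fin n → ℝ} (hR : IsCurvatureLike R) :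
    ∑ p, ∑ q, ∑ k, ∑ l, R q k p l • (e p * e q * (e l * e k - e k * e l))
      = -((2 : ℝ) • quadSum e R) - (6 * ∑ i, ∑ j, R i j i j) • (1 : A) := by
  rw [sum_cyclic (fun i j k => ∑ l, R i j k l • (e k * e i * (e l * e j - e j * e l)))]
  have h : ∀ i j k l, R i j k l • (e k * e i * (e l * e j - e j * e l))
      = (-2 : ℝ) • R i j k l • (e i * e j * e k * e l)
        + (if k = j then (-4 : ℝ) • R i j k l • (e i * e l) else 0)
        + (if l = j then (2 : ℝ) • R i j k l • (e i * e k) else 0)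
        + (if k = i then (4 : ℝ) • R i j k l • (e j * e l) else 0)
        + (if k = i then if l = j then (4 : ℝ) • R i j k l • (1 : A) else 0 else 0) := by
    intro i j k l
    have : e k * e i * (e l * e j - e j * e l)
        = (-2 : ℝ) • (e i * e j * e k * e l)
          + (if k = j then (-4 : ℝ) • (e i * e l) else 0)
          + (if l = j then (2 : ℝ) • (e i * e k) else 0)
          + (if k = i then (4 : ℝ) • (e j * e l) else 0)
          + (if k = i then if l = j then (4 : ℝ) • (1 : A) else 0 else 0) := by
      have h1 : e k * e i * (e l * e j - e j * e l)
          = 2 * (e i * (e k * e j) * e l) + (if l = j then 2 else 0) * (e i * e k)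
            + (if k = i then 4 else 0) * (e j * e l)
            + (if k = i then if l = j then 4 else 0 else 0) := by
        rw [he l j, he k i]
        split_ifs <;> noncomm_ring
        norm_num
      rw [h1, he k j]
      simp only [← algebraMap_smul A (-2 : ℝ), ← algebraMap_smul A (2 : ℝ),
        ← algebraMap_smul A (4 : ℝ), ← algebraMap_smul A (-4 : ℝ), map_neg, map_ofNat, smul_eq_mul]
      split_ifs <;> noncomm_ring <;> norm_num
    rw [this]
    simp only [smul_add, smul_ite, smul_zero, smul_comm (R i j k l)]
  simp_rw [h, Finset.sum_add_distrib, Finset.sum_ite_irrel, Finset.sum_const_zero,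
    Finset.sum_ite_eq', Finset.mem_univ, if_true, ← Finset.smul_sum]
  rw [he.sum_ricci hR, he.sum_ricci_middle hR, he.sum_ricci_right hR, ← quadSum]
  simp_rw [← Finset.sum_smul]
  module

/-- The square of an element of degree three. It is fixed by the reversal of products, so neither
degree two nor degree six occurs in it. -/
theorem CliffordRelations.cubicSum_mul_self (he : CliffordRelations e)
    (h12 : ∀ i j k, T j i k = -T i j k) (h23 : ∀ i j k, T i k j = -T i j k) :
    cubicSum e T * cubicSum e T
      = -((9 : ℝ) • quadSum e (wedgeSquare T))
        - (12 * ∑ i, ∑ j, wedgeSquare T i j i j) • (1 : A) := by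
  have hsq : ∑ p, slice e T p * slice e T p = quadSum e (wedgeSquare T) := by
    have hc : ∀ p i j, T p i j = T i j p := fun p i j => by
      rw [h12 i p j, h23 i j p, neg_neg]
    rw [sum_slice_mul_self, quadSum]
    simp_rw [wedgeSquare, hc]
  have h1 : cubicSum e T * cubicSum e T
      = ∑ p, ∑ q, e p * e q * (slice e T p * slice e T q)
        - (4 : ℝ) • ∑ q, slice e T q * slice e T q := by
    have h : ∀ p q, e p * slice e T p * (e q * slice e T q)
        = e p * e q * (slice e T p * slice e T q)
          + (4 : ℝ) • ((∑ k, T p q k • (e p * e k)) * slice e T q) := by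
      intro p q
      rw [mul_assoc, ← mul_assoc (slice e T p), he.slice_mul h23, add_mul, mul_add, smul_mul_assoc,
        mul_smul_comm, ← mul_assoc (e p) (∑ k, _), Finset.mul_sum]
      simp_rw [mul_smul_comm, mul_assoc]
    rw [cubicSum_eq, Finset.sum_mul]
    simp_rw [Finset.mul_sum, h, Finset.sum_add_distrib]
    rw [sub_eq_add_neg]
    congr 1
    rw [Finset.sum_comm, ← smul_neg, ← Finset.sum_neg_distrib, Finset.smul_sum]
    refine Finset.sum_congr rfl fun q _ => ?_
    rw [← Finset.smul_sum, ← Finset.sum_mul, ← neg_mul]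
    simp_rw [slice, h12 q, neg_smul, Finset.sum_neg_distrib]
  -- symmetrizing in `p` and `q` leaves only commutators of slices and a diagonal term
  have h2 : (2 : ℝ) • ∑ p, ∑ q, e p * e q * (slice e T p * slice e T q)
      = ∑ p, ∑ q, e p * e q * (slice e T p * slice e T q - slice e T q * slice e T p)
        - (2 : ℝ) • ∑ p, slice e T p * slice e T p := by
    have h : ∀ p q, e p * e q * (slice e T p * slice e T q - slice e T q * slice e T p)
        = e p * e q * (slice e T p * slice e T q) + e q * e p * (slice e T q * slice e T p)
          + if p = q then (2 : ℝ) • (slice e T q * slice e T p) else 0 := by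
      intro p q
      rw [mul_sub, sub_eq_add_neg, add_assoc]
      congr 1
      rw [he p q]
      split_ifs
      · rw [two_smul]; noncomm_ring
      · noncomm_ring
    simp_rw [h, Finset.sum_add_distrib, Finset.sum_ite_eq, Finset.mem_univ, if_true]
    rw [Finset.sum_comm (f := fun p q => e q * e p * (slice e T q * slice e T p)),
      ← Finset.smul_sum, two_smul]
    abel
  have h3 : ∑ p, ∑ q, e p * e q * (slice e T p * slice e T q - slice e T q * slice e T p)
      = (4 : ℝ) • (-((2 : ℝ) • quadSum e (wedgeSquare T))
        - (6 * ∑ i, ∑ j, wedgeSquare T i j i j) • (1 : A)) := by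
    rw [← he.sum_reordered (isCurvatureLike_wedgeSquare h12)]
    simp_rw [he.slice_commutator h23, mul_smul_comm, Finset.mul_sum, mul_smul_comm,
      ← Finset.smul_sum]
  rw [h3, hsq] at h2
  rw [h1, hsq, ← sub_eq_zero]
  refine (smul_eq_zero_iff_right (two_ne_zero (α := ℝ))).1 ?_
  rw [smul_sub, smul_sub, h2]
  module

/-- The square of an element of degree three when `wedgeSquare T` is completed by `R` to a tensor
with the first Bianchi identity: then the part of degree four can be expressed through `R`. -/
theorem CliffordRelations.cubicSum_mul_self_of_bianchi (he : CliffordRelations e)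
    (h12 : ∀ i j k, T j i k = -T i j k) (h23 : ∀ i j k, T i k j = -T i j k)
    {R : Fin n → Fin n → Fin n → Fin n → ℝ} (hR : IsCurvatureLike R)
    (hB : ∀ i j k l, (R i j k l + wedgeSquare T i j k l) + (R j k i l + wedgeSquare T j k i l)
      + (R k i j l + wedgeSquare T k i j l) = 0) :
    cubicSum e T * cubicSum e T = (9 : ℝ) • quadSum e R
      + (18 * ∑ i, ∑ j, R i j i j + 6 * ∑ i, ∑ j, wedgeSquare T i j i j) • (1 : A) := by
  have hW := isCurvatureLike_wedgeSquare h12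
  have h := he.quadSum_of_bianchi (R := fun i j k l => R i j k l + wedgeSquare T i j k l)
    ⟨fun i j k l => by rw [hR.antisymm, hW.antisymm, neg_add],
      fun i j k l => by rw [hR.pair_symm, hW.pair_symm]⟩ hB
  have h' : quadSum e (fun i j k l => R i j k l + wedgeSquare T i j k l)
      = quadSum e R + quadSum e (wedgeSquare T) := by
    simp_rw [quadSum, add_smul, Finset.sum_add_distrib]
  rw [h'] at h
  simp_rw [Finset.sum_add_distrib] at h
  rw [he.cubicSum_mul_self h12 h23, eq_sub_of_add_eq' h]
  module

end Relations

/-! ### Even elements that commute with all vectors -/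

section Words

variable {A : Type*} [Ring A] {n : ℕ} {e : Fin n → A}

/-- The product of the generators indexed by the letters of a word. -/
def word (e : Fin n → A) (w : List (Fin n)) : A := (w.map e).prod

theorem word_cons (i : Fin n) (w : List (Fin n)) : word e (i :: w) = e i * word e w := by
  simp [word]

theorem word_append (u v : List (Fin n)) : word e (u ++ v) = word e u * word e v := by
  simp [word]

variable [Algebra ℝ A]

/-- Moving a generator through a word produces one sign for each letter different from it. -/
theorem CliffordRelations.mul_word (he : CliffordRelations e) (i : Fin n) (w : List (Fin n)) :
    e i * word e w = ((-1 : ℝ) ^ (w.length + w.count i)) • (word e w * e i) := by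
  induction w with
  | nil => simp [word]
  | cons j w ih =>
    rw [word_cons, ← mul_assoc]
    by_cases h : i = j
    · subst h
      rw [mul_assoc]
      conv_lhs => rw [ih, mul_smul_comm, ← mul_assoc]
      rw [List.length_cons, List.count_cons_self]
      congr 1
      ring
    · rw [he i j, if_neg h, sub_zero, neg_mul, mul_assoc]
      conv_lhs => rw [ih, mul_smul_comm, ← mul_assoc, ← neg_smul]
      rw [List.length_cons, List.count_cons_of_ne (Ne.symm h)]
      congr 1
      ring

/-- A word in which each letter occurs an even number of times is a scalar. -/
theorem CliffordRelations.word_mem_span_one (he : CliffordRelations e) (w : List (Fin n))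
    (hw : ∀ i, Even (w.count i)) : word e w ∈ Submodule.span ℝ {(1 : A)} := by
  induction hN : w.length using Nat.strong_induction_on generalizing w with
  | _ N ih =>
    cases w with
    | nil => simp [word]
    | cons i w =>
      have hodd : ¬ Even (w.count i) := by
        have := hw i
        rwa [List.count_cons_self, Nat.even_add_one] at this
      have hi : i ∈ w := by
        by_contra h
        exact hodd (by simp [List.count_eq_zero_of_not_mem h])
      obtain ⟨u, v, rfl⟩ := List.append_of_mem hi
      have h : word e (i :: (u ++ i :: v))
          = (-(-1 : ℝ) ^ (u.length + u.count i)) • word e (u ++ v) := by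
        rw [word_cons, word_append, word_append, word_cons, ← mul_assoc, he.mul_word,
          smul_mul_assoc, mul_assoc, ← mul_assoc (e i), he.mul_self, neg_one_mul, mul_neg, smul_neg,
          neg_smul]
      rw [h]
      refine Submodule.smul_mem _ _ (ih (u ++ v).length ?_ (u ++ v) (fun j => ?_) rfl)
      · rw [← hN]; simp
      · have := hw j
        by_cases hj : i = j
        · subst hj
          simp only [List.count_cons_self, List.count_append] at this ⊢
          rwa [show u.count i + (v.count i + 1) + 1 = u.count i + v.count i + 2 by ring,
            Nat.even_add, iff_true_right (by decide)] at this
        · simpa [List.count_cons_of_ne, hj, List.count_append] using this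

/-- An element commuting with the generators is fixed by the averages `a ↦ (a - eᵢ a eᵢ) / 2`,
which kill the words of even length that contain the letter `i` an odd number of times. -/
theorem CliffordRelations.mem_span_one_of_commute (he : CliffordRelations e) {a : A}
    (ha : a ∈ Submodule.span ℝ {x | ∃ w : List (Fin n), Even w.length ∧ word e w = x})
    (hc : ∀ i, a * e i = e i * a) : a ∈ Submodule.span ℝ {(1 : A)} := by
  -- averaging over the generators in `s`, one after the other
  have key : ∀ s : Finset (Fin n), a ∈ Submodule.span ℝ
      {x | ∃ w : List (Fin n), (Even w.length ∧ ∀ i ∈ s, Even (w.count i)) ∧ word e w = x} := by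
    intro s
    induction s using Finset.induction_on with
    | empty => simpa using ha
    | insert i s _ ih =>
      let P : A →ₗ[ℝ] A := (1 / 2 : ℝ) • (LinearMap.id -
        (LinearMap.mulLeft ℝ (e i)) ∘ₗ (LinearMap.mulRight ℝ (e i)))
      have hP : P a = a := by
        have : e i * (a * e i) = -a := by rw [hc, ← mul_assoc, he.mul_self, neg_one_mul]
        simp only [P, LinearMap.smul_apply, LinearMap.sub_apply, LinearMap.id_apply,
          LinearMap.comp_apply, LinearMap.mulLeft_apply, LinearMap.mulRight_apply, this]
        module
      have := Submodule.mem_map_of_mem (f := P) ih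
      rw [hP, Submodule.map_span] at this
      refine Submodule.span_le.2 ?_ this
      rintro _ ⟨_, ⟨w, ⟨hw, hs⟩, rfl⟩, rfl⟩
      have hPw : P (word e w) = ((1 / 2 : ℝ) * (1 + (-1) ^ (w.count i))) • word e w := by
        simp only [P, LinearMap.smul_apply, LinearMap.sub_apply, LinearMap.id_apply,
          LinearMap.comp_apply, LinearMap.mulLeft_apply, LinearMap.mulRight_apply]
        rw [← mul_assoc, he.mul_word, smul_mul_assoc, mul_assoc, he.mul_self, pow_add, hw.neg_one_pow]
        simp only [mul_neg, mul_one]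
        module
      rw [hPw]
      by_cases hi : Even (w.count i)
      · refine Submodule.smul_mem _ _ (Submodule.subset_span ⟨w, ⟨hw, ?_⟩, rfl⟩)
        intro j hj
        rcases Finset.mem_insert.1 hj with rfl | hj
        exacts [hi, hs j hj]
      · rw [(Nat.not_even_iff_odd.1 hi).neg_one_pow]
        simp
  refine Submodule.span_le.2 ?_ (key Finset.univ)
  rintro _ ⟨w, ⟨_, hw⟩, rfl⟩
  exact he.word_mem_span_one w fun i => hw i (Finset.mem_univ i)

end Words

section CliffordAlgebra

variable {V : Type*} [AddCommGroup V] [Module ℝ V] {q : QuadraticForm ℝ V} {n : ℕ}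
  (Z : Module.Basis (Fin n) ℝ V)

open CliffordAlgebra

theorem even_le_span_word :
    Subalgebra.toSubmodule (even q) ≤ Submodule.span ℝ
      {x | ∃ w : List (Fin n), Even w.length ∧ word (fun i => ι q (Z i)) w = x} := by
  intro x hx
  refine even_induction q (motive := fun x _ => x ∈ Submodule.span ℝ
      {x | ∃ w : List (Fin n), Even w.length ∧ word (fun i => ι q (Z i)) w = x})
    (fun r => ?_) (fun x y _ _ hx hy => Submodule.add_mem _ hx hy) (fun v w x _ hx => ?_) x hx
  · rw [Algebra.algebraMap_eq_smul_one]
    exact Submodule.smul_mem _ _ (Submodule.subset_span ⟨[], by simp, by simp [word]⟩)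
  · rw [← Z.sum_repr v, ← Z.sum_repr w, map_sum, map_sum, Finset.sum_mul_sum, Finset.sum_mul]
    refine Submodule.sum_mem _ fun i _ => ?_
    rw [Finset.sum_mul]
    refine Submodule.sum_mem _ fun j _ => ?_
    rw [map_smul, map_smul, smul_mul_smul_comm, smul_mul_assoc]
    refine Submodule.smul_mem _ _ ?_
    have := Submodule.mem_map_of_mem
      (f := LinearMap.mulLeft ℝ (ι q (Z i) * ι q (Z j))) hx
    rw [Submodule.map_span] at this
    refine Submodule.span_mono ?_ this
    rintro _ ⟨_, ⟨u, hu, rfl⟩, rfl⟩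
    exact ⟨i :: j :: u, by simpa [Nat.even_add_one] using hu, by
      simp [word_cons]⟩

/-- An even element of the Clifford algebra that commutes with all vectors and is skew for the
canonical involution vanishes. -/
theorem eq_zero_of_even_of_commute (he : CliffordRelations fun i => ι q (Z i))
    {a : CliffordAlgebra q} (hev : a ∈ even q) (hstar : star a = -a)
    (hc : ∀ v, a * ι q v = ι q v * a) : a = 0 := by
  obtain ⟨r, rfl⟩ := Submodule.mem_span_singleton.1
    (he.mem_span_one_of_commute (even_le_span_word Z hev) fun i => hc (Z i))
  rw [CliffordAlgebra.star_smul, star_one] at hstar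
  have : (2 : ℝ) • (r • (1 : CliffordAlgebra q)) = 0 := by
    rw [two_smul]; nth_rewrite 1 [hstar]; abel
  exact (smul_eq_zero_iff_right two_ne_zero).1 this

theorem finite_cliffordAlgebra (he : CliffordRelations fun i => ι q (Z i)) :
    Module.Finite ℝ (CliffordAlgebra q) := by
  -- the ordered product of the planes spanned by `1` and `Z i` is everything
  let T : Fin n → Submodule ℝ (CliffordAlgebra q) := fun i => Submodule.span ℝ {1, ι q (Z i)}
  let W : Submodule ℝ (CliffordAlgebra q) := ((List.finRange n).map T).prod
  have hfg : ∀ l : List (Fin n), ((l.map T).prod).FG := by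
    intro l
    induction l with
    | nil => simpa [Submodule.one_eq_span] using Submodule.fg_span_singleton (1 : CliffordAlgebra q)
    | cons i l ih =>
      rw [List.map_cons, List.prod_cons]
      exact Submodule.FG.mul (Submodule.fg_span (by simp)) ih
  have h1 : ∀ l : List (Fin n), (1 : CliffordAlgebra q) ∈ (l.map T).prod := by
    intro l
    induction l with
    | nil => simp
    | cons i l ih =>
      rw [List.map_cons, List.prod_cons, ← one_mul (1 : CliffordAlgebra q)]
      exact Submodule.mul_mem_mul (Submodule.subset_span (by simp)) ih
  have hmul : ∀ (l : List (Fin n)) (i : Fin n), i ∈ l → ∀ x ∈ (l.map T).prod,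
      ι q (Z i) * x ∈ (l.map T).prod := by
    intro l
    induction l with
    | nil => simp
    | cons j l ih =>
      intro i hi x hx
      rw [List.map_cons, List.prod_cons] at hx ⊢
      refine Submodule.mul_induction_on hx (fun t ht y hy => ?_)
        (fun x y hx hy => by rw [mul_add]; exact Submodule.add_mem _ hx hy)
      obtain ⟨a, b, rfl⟩ := Submodule.mem_span_pair.1 ht
      by_cases h : i = j
      · subst h
        rw [← mul_assoc]
        refine Submodule.mul_mem_mul (Submodule.mem_span_pair.2 ⟨-b, a, ?_⟩) hy
        rw [mul_add, mul_smul_comm, mul_smul_comm, mul_one, he.mul_self]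
        module
      · have hil : i ∈ l := (List.mem_cons.1 hi).resolve_left h
        have hij : ι q (Z i) * ι q (Z j) = -(ι q (Z j) * ι q (Z i)) := by
          simpa [h] using he i j
        have : ι q (Z i) * ((a • 1 + b • ι q (Z j)) * y)
            = (a • 1 + (-b) • ι q (Z j)) * (ι q (Z i) * y) := by
          rw [← mul_assoc, ← mul_assoc]
          congr 1
          rw [mul_add, add_mul, mul_smul_comm, mul_smul_comm, smul_mul_assoc, smul_mul_assoc,
            mul_one, one_mul, hij]
          module
        rw [this]
        exact Submodule.mul_mem_mul (Submodule.mem_span_pair.2 ⟨a, -b, rfl⟩) (ih i hil y hy)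
  have htop : (⊤ : Submodule ℝ (CliffordAlgebra q)) ≤ W := by
    intro x _
    induction x using CliffordAlgebra.left_induction with
    | algebraMap r =>
      rw [Algebra.algebraMap_eq_smul_one]
      exact Submodule.smul_mem _ _ (h1 _)
    | add x y hx hy => exact Submodule.add_mem _ (hx trivial) (hy trivial)
    | ι_mul x v hx =>
      rw [← Z.sum_repr v, map_sum, Finset.sum_mul]
      refine Submodule.sum_mem _ fun i _ => ?_
      rw [map_smul, smul_mul_assoc]
      exact Submodule.smul_mem _ _ (hmul _ i (List.mem_finRange i) x (hx trivial))
  exact ⟨(top_le_iff.1 htop) ▸ hfg _⟩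

end CliffordAlgebra

/-! ### Mixed second derivatives on manifolds -/

section MixedDerivatives

variable {E : Type*} [NormedAddCommGroup E] [NormedSpace ℝ E]
  {G : Type*} [TopologicalSpace G] [ChartedSpace E G]
  {E' : Type*} [NormedAddCommGroup E'] [NormedSpace ℝ E']

/-- The derivative of a vector valued function on a manifold, as a map on the model space: at the
point `p` the tangent space is identified with the model space through the preferred chart. -/
def chartDeriv (h : G → E') (p : G) : E →L[ℝ] E' := mfderiv 𝓘(ℝ, E) 𝓘(ℝ, E') h p

/-- The vector valued function `h` on a manifold has the derivative `D` at `p`, expressed in the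
preferred chart at `p`. -/
def HasChartDerivAt (h : G → E') (D : E →L[ℝ] E') (p : G) : Prop :=
  ContinuousAt h p ∧
    HasFDerivAt (fun s => h ((extChartAt 𝓘(ℝ, E) p).symm s)) D (extChartAt 𝓘(ℝ, E) p p)

theorem hasChartDerivAt_iff {h : G → E'} {p : G} {D : E →L[ℝ] E'} :
    HasChartDerivAt h D p ↔ HasMFDerivAt 𝓘(ℝ, E) 𝓘(ℝ, E') h p D := by
  unfold HasMFDerivAt HasChartDerivAt
  rw [← hasFDerivWithinAt_univ]
  simp only [ModelWithCorners.range_eq_univ, writtenInExtChartAt, extChartAt_model_space_eq_id]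
  rfl

theorem HasChartDerivAt.chartDeriv {h : G → E'} {p : G} {D : E →L[ℝ] E'}
    (hh : HasChartDerivAt h D p) : chartDeriv h p = D :=
  (hasChartDerivAt_iff.1 hh).mfderiv

theorem HasChartDerivAt.mdifferentiableAt {h : G → E'} {p : G} {D : E →L[ℝ] E'}
    (hh : HasChartDerivAt h D p) : MDifferentiableAt 𝓘(ℝ, E) 𝓘(ℝ, E') h p :=
  (hasChartDerivAt_iff.1 hh).mdifferentiableAt

theorem _root_.MDifferentiableAt.hasChartDerivAt {h : G → E'} {p : G}
    (hh : MDifferentiableAt 𝓘(ℝ, E) 𝓘(ℝ, E') h p) :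
    HasChartDerivAt h (chartDeriv h p : E →L[ℝ] E') p :=
  hasChartDerivAt_iff.2 hh.hasMFDerivAt

theorem chartDeriv_eq_fderiv {h : G → E'} {p : G} (hh : MDifferentiableAt 𝓘(ℝ, E) 𝓘(ℝ, E') h p) :
    chartDeriv h p
      = fderiv ℝ (fun s => h ((extChartAt 𝓘(ℝ, E) p).symm s)) (extChartAt 𝓘(ℝ, E) p p) :=
  hh.hasChartDerivAt.2.fderiv.symm

theorem HasChartDerivAt.congr_of_eventuallyEq {h h' : G → E'} {p : G} {D : E →L[ℝ] E'}
    (hh : HasChartDerivAt h D p) (he : h' =ᶠ[nhds p] h) : HasChartDerivAt h' D p :=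
  hasChartDerivAt_iff.2 ((hasChartDerivAt_iff.1 hh).congr_of_eventuallyEq he)

theorem HasChartDerivAt.unique {h : G → E'} {p : G} {D D' : E →L[ℝ] E'}
    (hh : HasChartDerivAt h D p) (hh' : HasChartDerivAt h D' p) : D = D' :=
  hh.2.unique hh'.2

theorem HasChartDerivAt.clm_apply {E'' : Type*} [NormedAddCommGroup E''] [NormedSpace ℝ E'']
    {c : G → E' →L[ℝ] E''} {u : G → E'} {p : G} {c' : E →L[ℝ] E' →L[ℝ] E''} {u' : E →L[ℝ] E'}
    (hc : HasChartDerivAt c c' p) (hu : HasChartDerivAt u u' p) :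
    HasChartDerivAt (fun x => c x (u x)) ((c p).comp u' + c'.flip (u p)) p := by
  refine ⟨hc.1.clm_apply hu.1, ?_⟩
  have := hc.2.clm_apply hu.2
  rwa [extChartAt_to_inv] at this

theorem HasChartDerivAt.clm_comp {E'' : Type*} [NormedAddCommGroup E''] [NormedSpace ℝ E'']
    (L : E' →L[ℝ] E'') {u : G → E'} {p : G} {u' : E →L[ℝ] E'}
    (hu : HasChartDerivAt u u' p) :
    HasChartDerivAt (fun x => L (u x)) (L.comp u') p :=
  ⟨L.continuous.continuousAt.comp hu.1, L.hasFDerivAt.comp _ hu.2⟩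

variable [IsManifold 𝓘(ℝ, E) ∞ G]

theorem contDiffAt_comp_extChartAt_symm {h : G → E'} {p : G}
    (hh : ContMDiffAt 𝓘(ℝ, E) 𝓘(ℝ, E') ∞ h p) :
    ContDiffAt ℝ ∞ (fun s => h ((extChartAt 𝓘(ℝ, E) p).symm s)) (extChartAt 𝓘(ℝ, E) p p) := by
  have hs : ContMDiffAt 𝓘(ℝ, E) 𝓘(ℝ, E) ∞ (extChartAt 𝓘(ℝ, E) p).symm
      (extChartAt 𝓘(ℝ, E) p p) :=
    (contMDiffOn_extChartAt_symm p).contMDiffAt (extChartAt_target_mem_nhds p)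
  exact (ContMDiffAt.comp_of_eq hh hs (extChartAt_to_inv p)).contDiffAt

theorem eventually_mdifferentiableAt {M : Type*} [TopologicalSpace M] {F : Type*}
    [NormedAddCommGroup F] [NormedSpace ℝ F] {HF : Type*} [TopologicalSpace HF]
    {I : ModelWithCorners ℝ F HF} [ChartedSpace HF M] [IsManifold I ∞ M] {h : M → E'} {p : M}
    (hh : ContMDiffAt I 𝓘(ℝ, E') ∞ h p) :
    ∀ᶠ x in nhds p, MDifferentiableAt I 𝓘(ℝ, E') h x := by
  have h1 : ContMDiffAt I 𝓘(ℝ, E') 1 h p := hh.of_le (by exact_mod_cast le_top)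
  filter_upwards [(contMDiffAt_iff_contMDiffAt_nhds (by simp)).1 h1] with x hx
  exact hx.mdifferentiableAt one_ne_zero

/-- The two iterated partial derivatives of a smooth function on `G × G` at a diagonal point are
given by the same bilinear map. -/
theorem exists_mixed_derivative {F : G × G → E'} {p : G}
    (hF : ContMDiffAt (𝓘(ℝ, E).prod 𝓘(ℝ, E)) 𝓘(ℝ, E') ∞ F (p, p)) :
    ∃ B : E →L[ℝ] E →L[ℝ] E',
      HasChartDerivAt (fun x => chartDeriv (fun y => F (x, y)) p) B p ∧
      HasChartDerivAt (fun y => chartDeriv (fun x => F (x, y)) p) B.flip p := by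
  set φ := extChartAt 𝓘(ℝ, E) p with hφ
  let f : E × E → E' := fun st => F (φ.symm st.1, φ.symm st.2)
  have hs : ContMDiffAt 𝓘(ℝ, E) 𝓘(ℝ, E) ∞ φ.symm (φ p) :=
    (contMDiffOn_extChartAt_symm p).contMDiffAt (extChartAt_target_mem_nhds p)
  have hpp : φ.symm (φ p) = p := extChartAt_to_inv p
  have hf : ContDiffAt ℝ ∞ f (φ p, φ p) := by
    have h1 : ContMDiffAt 𝓘(ℝ, E × E) 𝓘(ℝ, E) ∞ (fun st : E × E => φ.symm st.1) (φ p, φ p) :=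
      ContMDiffAt.comp (g := φ.symm) (φ p, φ p) hs contDiff_fst.contMDiff.contMDiffAt
    have h2 : ContMDiffAt 𝓘(ℝ, E × E) 𝓘(ℝ, E) ∞ (fun st : E × E => φ.symm st.2) (φ p, φ p) :=
      ContMDiffAt.comp (g := φ.symm) (φ p, φ p) hs contDiff_snd.contMDiff.contMDiffAt
    exact (ContMDiffAt.comp_of_eq (f := fun st : E × E => (φ.symm st.1, φ.symm st.2)) hF
      (h1.prodMk h2) (by simp [hpp])).contDiffAt
  have hf1 : DifferentiableAt ℝ (fderiv ℝ f) (φ p, φ p) :=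
    (hf.fderiv_right (m := 1)
      (by rw [one_add_one_eq_two]; exact ENat.LEInfty.out)).differentiableAt one_ne_zero
  have hev : ∀ᶠ z in nhds (φ p, φ p), DifferentiableAt ℝ f z := by
    have h1 : ContDiffAt ℝ 1 f (φ p, φ p) := hf.of_le (by exact_mod_cast le_top)
    filter_upwards [h1.eventually (by simp)] with z hz
    exact hz.differentiableAt one_ne_zero
  have hdF := eventually_mdifferentiableAt hF
  have hsymm : IsSymmSndFDerivAt ℝ f (φ p, φ p) :=
    hf.isSymmSndFDerivAt (by simpa using ENat.LEInfty.out)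
  let D := fderiv ℝ (fderiv ℝ f) (φ p, φ p)
  -- restriction of a linear map to the two factors
  let R1 : (E × E →L[ℝ] E') →L[ℝ] (E →L[ℝ] E') :=
    (ContinuousLinearMap.compL ℝ E (E × E) E').flip (ContinuousLinearMap.inl ℝ E E)
  let R2 : (E × E →L[ℝ] E') →L[ℝ] (E →L[ℝ] E') :=
    (ContinuousLinearMap.compL ℝ E (E × E) E').flip (ContinuousLinearMap.inr ℝ E E)
  have c1 : Continuous fun s : E => (s, φ p) := by fun_prop
  have c2 : Continuous fun s : E => (φ p, s) := by fun_prop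
  have k1 : Continuous fun x : G => (x, p) := by fun_prop
  have k2 : Continuous fun x : G => (p, x) := by fun_prop
  refine ⟨R2.comp (D.comp (ContinuousLinearMap.inl ℝ E E)), ?_, ?_⟩
  · have hloc : (fun x => chartDeriv (fun y => F (x, y)) p)
        =ᶠ[nhds p] fun x => R2 (fderiv ℝ f (φ x, φ p)) := by
      have ha : ∀ᶠ x in nhds p, DifferentiableAt ℝ f (φ x, φ p) :=
        (c1.continuousAt.comp (continuousAt_extChartAt p)).eventually hev
      filter_upwards [ha, k1.continuousAt.eventually hdF,
        extChartAt_source_mem_nhds (I := 𝓘(ℝ, E)) p]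
        with x hx hx' hxs
      have hm : MDifferentiableAt 𝓘(ℝ, E) 𝓘(ℝ, E') (fun y => F (x, y)) p :=
        MDifferentiableAt.comp (g := F) p hx' (mdifferentiableAt_const.prodMk mdifferentiableAt_id)
      rw [chartDeriv_eq_fderiv hm]
      have : (fun s => F (x, φ.symm s)) = fun s => f (φ x, s) := by
        funext s
        simp only [f]
        rw [φ.left_inv hxs]
      rw [this]
      exact (hx.hasFDerivAt.comp (φ p) (hasFDerivAt_prodMk_right (φ x) (φ p))).fderiv
    refine HasChartDerivAt.congr_of_eventuallyEq ?_ hloc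
    refine ⟨?_, ?_⟩
    · exact R2.continuous.continuousAt.comp (ContinuousAt.comp (g := fderiv ℝ f)
        (f := fun x => (φ x, φ p)) hf1.continuousAt
        (c1.continuousAt.comp (continuousAt_extChartAt p)))
    · have h1 : HasFDerivAt (fun s => R2 (fderiv ℝ f (s, φ p)))
          (R2.comp (D.comp (ContinuousLinearMap.inl ℝ E E))) (φ p) :=
        R2.hasFDerivAt.comp (φ p) (HasFDerivAt.comp (g := fderiv ℝ f) (f := fun s => (s, φ p)) (φ p)
          hf1.hasFDerivAt (hasFDerivAt_prodMk_left (φ p) (φ p)))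
      refine h1.congr_of_eventuallyEq ?_
      filter_upwards [extChartAt_target_mem_nhds (I := 𝓘(ℝ, E)) p] with s hs
      rw [← hφ, φ.right_inv hs]
  · have hloc : (fun y => chartDeriv (fun x => F (x, y)) p)
        =ᶠ[nhds p] fun x => R1 (fderiv ℝ f (φ p, φ x)) := by
      have ha : ∀ᶠ x in nhds p, DifferentiableAt ℝ f (φ p, φ x) :=
        (c2.continuousAt.comp (continuousAt_extChartAt p)).eventually hev
      filter_upwards [ha, k2.continuousAt.eventually hdF,
        extChartAt_source_mem_nhds (I := 𝓘(ℝ, E)) p]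
        with x hx hx' hxs
      have hm : MDifferentiableAt 𝓘(ℝ, E) 𝓘(ℝ, E') (fun y => F (y, x)) p :=
        MDifferentiableAt.comp (g := F) p hx' (mdifferentiableAt_id.prodMk mdifferentiableAt_const)
      rw [chartDeriv_eq_fderiv hm]
      have : (fun s => F (φ.symm s, x)) = fun s => f (s, φ x) := by
        funext s
        simp only [f]
        rw [φ.left_inv hxs]
      rw [this]
      exact (HasFDerivAt.comp (g := f) (f := fun s => (s, φ x)) (φ p) hx.hasFDerivAt
        (hasFDerivAt_prodMk_left (φ p) (φ x))).fderiv
    have hflip : (R2.comp (D.comp (ContinuousLinearMap.inl ℝ E E))).flip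
        = R1.comp (D.comp (ContinuousLinearMap.inr ℝ E E)) := by
      ext u v
      exact hsymm _ _
    rw [hflip]
    refine HasChartDerivAt.congr_of_eventuallyEq ?_ hloc
    refine ⟨?_, ?_⟩
    · exact R1.continuous.continuousAt.comp (ContinuousAt.comp (g := fderiv ℝ f)
        (f := fun x => (φ p, φ x)) hf1.continuousAt
        (c2.continuousAt.comp (continuousAt_extChartAt p)))
    · have h1 : HasFDerivAt (fun s => R1 (fderiv ℝ f (φ p, s)))
          (R1.comp (D.comp (ContinuousLinearMap.inr ℝ E E))) (φ p) :=
        R1.hasFDerivAt.comp (φ p) (HasFDerivAt.comp (g := fderiv ℝ f) (f := fun s => (φ p, s)) (φ p)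
          hf1.hasFDerivAt (hasFDerivAt_prodMk_right (φ p) (φ p)))
      refine h1.congr_of_eventuallyEq ?_
      filter_upwards [extChartAt_target_mem_nhds (I := 𝓘(ℝ, E)) p] with s hs
      rw [← hφ, φ.right_inv hs]

end MixedDerivatives

/-! ### Left invariant derivatives and the adjoint representation -/

section LieGroupCalculus

variable {E : Type*} [NormedAddCommGroup E] [NormedSpace ℝ E]
  {G : Type*} [TopologicalSpace G] [ChartedSpace E G]
  {E' : Type*} [NormedAddCommGroup E'] [NormedSpace ℝ E']

theorem hasChartDerivAt_extChartAt [IsManifold 𝓘(ℝ, E) ∞ G] (p : G) :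
    HasChartDerivAt (extChartAt 𝓘(ℝ, E) p) (ContinuousLinearMap.id ℝ E) p := by
  refine ⟨continuousAt_extChartAt p, (hasFDerivAt_id _).congr_of_eventuallyEq ?_⟩
  filter_upwards [extChartAt_target_mem_nhds (I := 𝓘(ℝ, E)) p] with s hs
  exact (extChartAt 𝓘(ℝ, E) p).right_inv hs

variable [Group G]

/-- The identification of the Lie algebra, the tangent space at the identity, with the model space
of the manifold. -/
def toModel : GroupLieAlgebra 𝓘(ℝ, E) G ≃ₗ[ℝ] E where
  toFun X := X
  invFun X := X
  map_add' _ _ := rfl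
  map_smul' _ _ := rfl

variable [LieGroup 𝓘(ℝ, E) ∞ G]

theorem mdifferentiableAt_mul_left' (g x : G) :
    MDifferentiableAt 𝓘(ℝ, E) 𝓘(ℝ, E) (fun y : G => g * y) x :=
  (contMDiff_mul_left (I := 𝓘(ℝ, E)) (n := ∞) (a := g)).mdifferentiableAt (by simp)

theorem mdifferentiableAt_mul_right' (g x : G) :
    MDifferentiableAt 𝓘(ℝ, E) 𝓘(ℝ, E) (fun y : G => y * g) x :=
  (contMDiff_mul_right (I := 𝓘(ℝ, E)) (n := ∞) (a := g)).mdifferentiableAt (by simp)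

theorem leftDeriv_eq_chartDeriv {f : G → E'} {g : G}
    (hf : MDifferentiableAt 𝓘(ℝ, E) 𝓘(ℝ, E') f g) (X : GroupLieAlgebra 𝓘(ℝ, E) G) :
    leftDeriv X f g = chartDeriv (fun y => f (g * y)) 1 (toModel X) :=
  (mfderiv_comp_apply_of_eq (x := (1 : G)) (f := fun y => g * y) hf
    (mdifferentiableAt_mul_left' g 1) (mul_one g) X).symm

theorem leftDeriv_one {f : G → E'}
    (hf : MDifferentiableAt 𝓘(ℝ, E) 𝓘(ℝ, E') f 1) (X : GroupLieAlgebra 𝓘(ℝ, E) G) :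
    leftDeriv X f 1 = chartDeriv f 1 (toModel X) := by
  rw [leftDeriv_eq_chartDeriv hf]
  simp only [one_mul]

/-- The mixed second derivative at the identity of `(x, y) ↦ f (x y)`. -/
theorem exists_mixed_derivative_mul {f : G → E'}
    (hf : ContMDiffAt 𝓘(ℝ, E) 𝓘(ℝ, E') ∞ f 1) :
    ∃ B : E →L[ℝ] E →L[ℝ] E',
      HasChartDerivAt (fun x : G => chartDeriv (fun y => f (x * y)) 1) B 1 ∧
      HasChartDerivAt (fun y : G => chartDeriv (fun x => f (x * y)) 1) B.flip 1 :=
  exists_mixed_derivative (F := fun z : G × G => f (z.1 * z.2))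
    (ContMDiffAt.comp_of_eq (g := f) (f := fun z : G × G => z.1 * z.2) hf
      (contMDiff_mul 𝓘(ℝ, E) ∞).contMDiffAt (mul_one 1))

theorem hasChartDerivAt_leftDeriv {f : G → E'}
    (hf : ContMDiffAt 𝓘(ℝ, E) 𝓘(ℝ, E') ∞ f 1) {B : E →L[ℝ] E →L[ℝ] E'}
    (hB : HasChartDerivAt (fun x : G => chartDeriv (fun y => f (x * y)) 1) B 1)
    (X : GroupLieAlgebra 𝓘(ℝ, E) G) :
    HasChartDerivAt (leftDeriv X f) (B.flip (toModel X)) 1 := by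
  have h := hB.clm_comp (ContinuousLinearMap.apply ℝ E' (toModel X))
  refine HasChartDerivAt.congr_of_eventuallyEq (h := fun x : G =>
    chartDeriv (fun y => f (x * y)) 1 (toModel X)) h ?_
  filter_upwards [eventually_mdifferentiableAt hf] with x hx
  exact leftDeriv_eq_chartDeriv hx X

/-- The bracket of two vectors of the Lie algebra is the antisymmetrized mixed second derivative
of the multiplication in the preferred chart at the identity. -/
theorem bracket_eq_mixed [FiniteDimensional ℝ E] {B : E →L[ℝ] E →L[ℝ] E}
    (hB : HasChartDerivAt
      (fun x : G => chartDeriv (fun y => extChartAt 𝓘(ℝ, E) (1 : G) (x * y)) 1) B 1)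
    (X Y : GroupLieAlgebra 𝓘(ℝ, E) G) :
    toModel (⁅X, Y⁆ : GroupLieAlgebra 𝓘(ℝ, E) G)
      = B (toModel X) (toModel Y) - B (toModel Y) (toModel X) := by
  set φ := extChartAt 𝓘(ℝ, E) (1 : G) with hφ
  have hsm : ContMDiffAt 𝓘(ℝ, E) 𝓘(ℝ, E) ∞ φ 1 := contMDiffAt_extChartAt
  have hone : ∀ X : GroupLieAlgebra 𝓘(ℝ, E) G, leftDeriv X φ 1 = toModel X := fun X => by
    rw [leftDeriv_one (hasChartDerivAt_extChartAt (1 : G)).mdifferentiableAt,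
      (hasChartDerivAt_extChartAt (1 : G)).chartDeriv]
    rfl
  -- in the chart, an invariant field is the derivative of the chart along the field
  have hpb : ∀ X : GroupLieAlgebra 𝓘(ℝ, E) G,
      (fun s : E => (VectorField.mpullbackWithin 𝓘(ℝ, E) 𝓘(ℝ, E) φ.symm
        (mulInvariantVectorField X) (Set.range 𝓘(ℝ, E)) s : E))
        =ᶠ[nhds (φ 1)] fun s => leftDeriv X φ (φ.symm s) := by
    intro X
    filter_upwards [extChartAt_target_mem_nhds (I := 𝓘(ℝ, E)) (1 : G)] with s hs
    rw [VectorField.mpullbackWithin_apply, leftDeriv]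
    congr 1
    exact ContinuousLinearMap.inverse_eq
      (mfderivWithin_extChartAt_symm_comp_mfderiv_extChartAt hs)
      (mfderiv_extChartAt_comp_mfderivWithin_extChartAt_symm hs)
  have hL : ∀ X : GroupLieAlgebra 𝓘(ℝ, E) G,
      HasFDerivAt (fun s => leftDeriv X φ (φ.symm s)) (B.flip (toModel X)) (φ 1) :=
    fun X => (hasChartDerivAt_leftDeriv hsm hB X).2
  have hsymm1 : φ.symm (φ 1) = 1 := extChartAt_to_inv 1
  have key : ∀ V W : E → E, (V =ᶠ[nhds (φ 1)] fun s => leftDeriv X φ (φ.symm s)) →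
      (W =ᶠ[nhds (φ 1)] fun s => leftDeriv Y φ (φ.symm s)) →
      VectorField.lieBracketWithin ℝ V W Set.univ (φ 1)
        = B (toModel X) (toModel Y) - B (toModel Y) (toModel X) := by
    intro V W hV hW
    rw [VectorField.lieBracketWithin_univ, hV.lieBracket_vectorField_eq hW,
      VectorField.lieBracket_eq]
    simp only [(hL X).fderiv, (hL Y).fderiv, hsymm1, hone, ContinuousLinearMap.flip_apply]
  have hinv : (chartDeriv φ 1).inverse = ContinuousLinearMap.id ℝ E := by
    rw [(hasChartDerivAt_extChartAt (1 : G)).chartDeriv, ContinuousLinearMap.inverse_id]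
  rw [GroupLieAlgebra.bracket_def, ← VectorField.mlieBracketWithin_univ,
    VectorField.mlieBracketWithin_apply, Set.preimage_univ, Set.univ_inter]
  refine Eq.trans ?_ (key _ _ (hpb X) (hpb Y))
  rw [ModelWithCorners.range_eq_univ]
  exact congrArg (fun L : E →L[ℝ] E => L _) hinv

/-- The commutator of left invariant derivatives at the identity. -/
theorem chartDeriv_leftDeriv_sub [FiniteDimensional ℝ E] {f : G → E'}
    (hf : ContMDiffAt 𝓘(ℝ, E) 𝓘(ℝ, E') ∞ f 1) (X Y : GroupLieAlgebra 𝓘(ℝ, E) G) :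
    chartDeriv (leftDeriv Y f) 1 (toModel X) - chartDeriv (leftDeriv X f) 1 (toModel Y)
      = leftDeriv (⁅X, Y⁆ : GroupLieAlgebra 𝓘(ℝ, E) G) f 1 := by
  set φ := extChartAt 𝓘(ℝ, E) (1 : G) with hφ
  have hsm : ContMDiffAt 𝓘(ℝ, E) 𝓘(ℝ, E) ∞ φ 1 := contMDiffAt_extChartAt
  obtain ⟨B, hB, -⟩ := exists_mixed_derivative_mul hsm
  have hφ1 := hasChartDerivAt_extChartAt (E := E) (1 : G)
  let fc : E → E' := fun s => f (φ.symm s)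
  have hfc : ContDiffAt ℝ ∞ fc (φ 1) := contDiffAt_comp_extChartAt_symm hf
  have hfc1 : DifferentiableAt ℝ (fderiv ℝ fc) (φ 1) :=
    (hfc.fderiv_right (m := 1)
      (by rw [one_add_one_eq_two]; exact ENat.LEInfty.out)).differentiableAt one_ne_zero
  let D := fderiv ℝ (fderiv ℝ fc) (φ 1)
  have hsymm : IsSymmSndFDerivAt ℝ fc (φ 1) :=
    hfc.isSymmSndFDerivAt (by simpa using ENat.LEInfty.out)
  have hone : ∀ X : GroupLieAlgebra 𝓘(ℝ, E) G, leftDeriv X φ 1 = toModel X := fun X => by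
    rw [leftDeriv_one hφ1.mdifferentiableAt, hφ1.chartDeriv]
    rfl
  have hD : HasChartDerivAt (fun x : G => fderiv ℝ fc (φ x)) D 1 := by
    refine ⟨ContinuousAt.comp (g := fderiv ℝ fc) hfc1.continuousAt (continuousAt_extChartAt 1),
      hfc1.hasFDerivAt.congr_of_eventuallyEq ?_⟩
    filter_upwards [extChartAt_target_mem_nhds (I := 𝓘(ℝ, E)) (1 : G)] with s hs
    rw [← hφ, φ.right_inv hs]
  have hd : ∀ᶠ x in nhds (1 : G), DifferentiableAt ℝ fc (φ x) := by
    have h1 : ContDiffAt ℝ 1 fc (φ 1) := hfc.of_le ENat.LEInfty.out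
    have h2 : ∀ᶠ s in nhds (φ 1), DifferentiableAt ℝ fc s := by
      filter_upwards [h1.eventually (by simp)] with z hz
      exact hz.differentiableAt one_ne_zero
    exact (continuousAt_extChartAt (I := 𝓘(ℝ, E)) (1 : G)).eventually h2
  -- the chain rule through the chart; the second derivative of `fc` that it produces is symmetric
  have hloc : ∀ X : GroupLieAlgebra 𝓘(ℝ, E) G,
      leftDeriv X f =ᶠ[nhds 1] fun x => fderiv ℝ fc (φ x) (leftDeriv X φ x) := by
    intro X
    filter_upwards [hd, eventually_mdifferentiableAt hsm,
      eventually_mem_nhds_iff.2 (extChartAt_source_mem_nhds (I := 𝓘(ℝ, E)) (1 : G))]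
      with x hx hx' hs
    have he : f =ᶠ[nhds x] fc ∘ φ := by
      filter_upwards [hs] with y hy
      simp only [fc, Function.comp_apply]
      rw [φ.left_inv hy]
    rw [leftDeriv, leftDeriv, he.mfderiv_eq]
    refine (mfderiv_comp_apply x hx.mdifferentiableAt hx' _).trans ?_
    rw [mfderiv_eq_fderiv]
    rfl
  have hder : ∀ X : GroupLieAlgebra 𝓘(ℝ, E) G, chartDeriv (leftDeriv X f) 1
      = (fderiv ℝ fc (φ 1)).comp (B.flip (toModel X)) + D.flip (toModel X) := by
    intro X
    have := hD.clm_apply (hasChartDerivAt_leftDeriv hsm hB X)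
    rw [hone] at this
    exact (this.congr_of_eventuallyEq (hloc X)).chartDeriv
  have hr : leftDeriv (⁅X, Y⁆ : GroupLieAlgebra 𝓘(ℝ, E) G) f 1
      = fderiv ℝ fc (φ 1)
        (B (toModel X) (toModel Y) - B (toModel Y) (toModel X)) := by
    rw [(hloc _).eq_of_nhds, hone, bracket_eq_mixed hB]
  rw [hr, hder, hder]
  have hs := hsymm (toModel X) (toModel Y)
  simp only [add_apply, ContinuousLinearMap.comp_apply,
    ContinuousLinearMap.flip_apply, map_sub]
  have hs' : D (toModel X) (toModel Y) = D (toModel Y) (toModel X) := hs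
  rw [hs']
  abel

theorem leftDeriv_mul_left {f : G → E'} (hf : ContMDiff 𝓘(ℝ, E) 𝓘(ℝ, E') ∞ f) (g x : G)
    (X : GroupLieAlgebra 𝓘(ℝ, E) G) :
    leftDeriv X f (g * x) = leftDeriv X (fun y => f (g * y)) x := by
  have h : ∀ y, MDifferentiableAt 𝓘(ℝ, E) 𝓘(ℝ, E') f y :=
    fun y => hf.mdifferentiableAt (by simp)
  rw [leftDeriv_eq_chartDeriv (h _), leftDeriv_eq_chartDeriv (f := fun y => f (g * y))
    ((h (g * x)).comp x (mdifferentiableAt_mul_left' g x))]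
  simp only [mul_assoc]

theorem contMDiff_comp_mul_left {f : G → E'} (hf : ContMDiff 𝓘(ℝ, E) 𝓘(ℝ, E') ∞ f) (g : G) :
    ContMDiff 𝓘(ℝ, E) 𝓘(ℝ, E') ∞ (fun y => f (g * y)) :=
  hf.comp contMDiff_mul_left

theorem mdifferentiableAt_leftDeriv {f : G → E'} (hf : ContMDiff 𝓘(ℝ, E) 𝓘(ℝ, E') ∞ f) (g : G)
    (X : GroupLieAlgebra 𝓘(ℝ, E) G) :
    MDifferentiableAt 𝓘(ℝ, E) 𝓘(ℝ, E') (leftDeriv X f) g := by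
  have hg := (contMDiff_comp_mul_left hf g).contMDiffAt (x := 1)
  obtain ⟨B, hB, -⟩ := exists_mixed_derivative_mul hg
  have h1 := (hasChartDerivAt_leftDeriv hg hB X).mdifferentiableAt
  have h2 : leftDeriv X f = leftDeriv X (fun y => f (g * y)) ∘ fun z => g⁻¹ * z := by
    funext z
    rw [Function.comp_apply, ← leftDeriv_mul_left hf, mul_inv_cancel_left]
  rw [h2]
  exact MDifferentiableAt.comp_of_eq (x := g) h1 (mdifferentiableAt_mul_left' g⁻¹ g)
    (inv_mul_cancel g)

/-- Left invariant derivatives form a representation of the Lie algebra. -/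
theorem leftDeriv_comm [FiniteDimensional ℝ E] {f : G → E'}
    (hf : ContMDiff 𝓘(ℝ, E) 𝓘(ℝ, E') ∞ f) (X Y : GroupLieAlgebra 𝓘(ℝ, E) G) (g : G) :
    leftDeriv X (leftDeriv Y f) g - leftDeriv Y (leftDeriv X f) g
      = leftDeriv (⁅X, Y⁆ : GroupLieAlgebra 𝓘(ℝ, E) G) f g := by
  have h : ∀ Z : GroupLieAlgebra 𝓘(ℝ, E) G,
      leftDeriv Z f g = leftDeriv Z (fun y => f (g * y)) 1 := fun Z => by
    rw [← leftDeriv_mul_left hf, mul_one]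
  rw [h, ← chartDeriv_leftDeriv_sub (contMDiff_comp_mul_left hf g).contMDiffAt,
    leftDeriv_eq_chartDeriv (mdifferentiableAt_leftDeriv hf g Y),
    leftDeriv_eq_chartDeriv (mdifferentiableAt_leftDeriv hf g X)]
  simp only [leftDeriv_mul_left hf]

theorem mdifferentiableAt_conj (g x : G) :
    MDifferentiableAt 𝓘(ℝ, E) 𝓘(ℝ, E) (fun x : G => g * x * g⁻¹) x :=
  MDifferentiableAt.comp (g := fun y => y * g⁻¹) x
    (mdifferentiableAt_mul_right' g⁻¹ _) (mdifferentiableAt_mul_left' g x)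

theorem toModel_Ad (g : G) (Y : GroupLieAlgebra 𝓘(ℝ, E) G) :
    toModel (Ad g Y)
      = chartDeriv (fun x => extChartAt 𝓘(ℝ, E) (1 : G) (g * x * g⁻¹)) 1 (toModel Y) := by
  have hφ1 := hasChartDerivAt_extChartAt (E := E) (1 : G)
  symm
  refine (mfderiv_comp_apply_of_eq (x := (1 : G)) (f := fun x => g * x * g⁻¹)
    (g := extChartAt 𝓘(ℝ, E) (1 : G))
    hφ1.mdifferentiableAt (mdifferentiableAt_conj g 1) (by simp) Y).trans ?_
  exact congrArg (fun L : E →L[ℝ] E => L _) hφ1.chartDeriv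

theorem Ad_one (Y : GroupLieAlgebra 𝓘(ℝ, E) G) : Ad (1 : G) Y = Y := by
  apply toModel.injective
  rw [toModel_Ad]
  simp only [one_mul, inv_one, mul_one]
  exact congrArg (fun L : E →L[ℝ] E => L (toModel Y))
    (hasChartDerivAt_extChartAt (1 : G)).chartDeriv

/-- The differential of the adjoint representation is the Lie bracket. Writing
`x y = (x y x⁻¹) x`, the derivative in `y` of a left translation is a right translation after `Ad`;
this relation is differentiated in `x`. -/
theorem exists_hasChartDerivAt_Ad [FiniteDimensional ℝ E] (Y : GroupLieAlgebra 𝓘(ℝ, E) G) :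
    ∃ D : E →L[ℝ] E, HasChartDerivAt (fun g : G => toModel (Ad g Y)) D 1 ∧
      ∀ X : GroupLieAlgebra 𝓘(ℝ, E) G,
        D (toModel X) = toModel (⁅X, Y⁆ : GroupLieAlgebra 𝓘(ℝ, E) G) := by
  set φ := extChartAt 𝓘(ℝ, E) (1 : G) with hφ
  have hsm : ContMDiffAt 𝓘(ℝ, E) 𝓘(ℝ, E) ∞ φ 1 := contMDiffAt_extChartAt
  have hφ1 := hasChartDerivAt_extChartAt (E := E) (1 : G)
  obtain ⟨B, hB, hB'⟩ := exists_mixed_derivative_mul hsm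
  have hconj : ContMDiff (𝓘(ℝ, E).prod 𝓘(ℝ, E)) 𝓘(ℝ, E) ∞
      (fun z : G × G => z.1 * z.2 * z.1⁻¹) :=
    (contMDiff_fst.mul contMDiff_snd).mul contMDiff_fst.inv
  obtain ⟨C, hC, -⟩ := exists_mixed_derivative
    (F := fun z : G × G => φ (z.1 * z.2 * z.1⁻¹)) (p := 1)
    (ContMDiffAt.comp_of_eq (g := φ) (f := fun z : G × G => z.1 * z.2 * z.1⁻¹) hsm
      hconj.contMDiffAt (by simp))
  have hAdD : HasChartDerivAt (fun g : G => toModel (Ad g Y)) (C.flip (toModel Y)) 1 := by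
    have h := hC.clm_comp (ContinuousLinearMap.apply ℝ E (toModel Y))
    refine HasChartDerivAt.congr_of_eventuallyEq h (Filter.Eventually.of_forall fun g => ?_)
    exact toModel_Ad g Y
  refine ⟨_, hAdD, fun X => ?_⟩
  have h1 := hB.clm_comp (ContinuousLinearMap.apply ℝ E (toModel Y))
  have h2 := hB'.clm_apply hAdD
  -- the chain rule for `x y = (x y x⁻¹) x`
  have heq : (fun x : G => ContinuousLinearMap.apply ℝ E (toModel Y)
        (chartDeriv (fun y => φ (x * y)) 1))
      =ᶠ[nhds 1] fun y => chartDeriv (fun x => φ (x * y)) 1 (toModel (Ad y Y)) := by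
    filter_upwards [eventually_mdifferentiableAt hsm] with x hx
    have hc : (fun y => φ (x * y)) = (fun z => φ (z * x)) ∘ fun y => x * y * x⁻¹ := by
      funext y; simp
    rw [hc]
    refine mfderiv_comp_apply_of_eq (x := (1 : G)) (f := fun y => x * y * x⁻¹) (y := 1)
      (g := fun z => φ (z * x)) ?_ (mdifferentiableAt_conj x 1) (by simp) Y
    exact MDifferentiableAt.comp_of_eq (1 : G) hx (mdifferentiableAt_mul_right' x 1) (one_mul x)
  have h3 := h1.unique (h2.congr_of_eventuallyEq heq)
  have h4 := congrArg (fun L : E →L[ℝ] E => L (toModel X)) h3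
  have hid : chartDeriv (fun x => φ (x * 1)) 1 = ContinuousLinearMap.id ℝ E := by
    simp only [mul_one]
    exact hφ1.chartDeriv
  rw [bracket_eq_mixed hB]
  simp only [hid, Ad_one, ContinuousLinearMap.comp_apply, add_apply,
    ContinuousLinearMap.flip_apply, ContinuousLinearMap.apply_apply,
    ContinuousLinearMap.id_apply] at h4 ⊢
  exact eq_sub_of_add_eq h4.symm

end LieGroupCalculus

/-! ### Brackets and invariant forms on a naturally reductive space -/

section Geometry

variable {E : Type*} [NormedAddCommGroup E] [NormedSpace ℝ E]
  {G : Type*} [TopologicalSpace G] [ChartedSpace E G] [Group G]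

/-- A smooth Lie group is smooth enough for its tangent space to be a Lie algebra. -/
instance lieGroup_minSmoothness [LieGroup 𝓘(ℝ, E) ∞ G] :
    LieGroup 𝓘(ℝ, E) (minSmoothness ℝ 3) G :=
  LieGroup.of_le (n := ∞) (by simpa using ENat.LEInfty.out)

variable {F : Type*} [NormedAddCommGroup F] [NormedSpace ℝ F]
  {H : Subgroup G} [ChartedSpace F H]

namespace Space

variable (M : Space E F H)

/-- The projection onto `𝔪` as a linear map. -/
def toMₗ : GroupLieAlgebra 𝓘(ℝ, E) G →ₗ[ℝ] M.m := M.m.projectionOnto _ M.isCompl.symm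

theorem toM_eq (X : GroupLieAlgebra 𝓘(ℝ, E) G) : M.toM X = M.toMₗ X := rfl

theorem toM_coe (X : M.m) : M.toM X.1 = X := Submodule.projectionOnto_apply_left _ X

theorem toM_add_toH (X : GroupLieAlgebra 𝓘(ℝ, E) G) : (M.toM X).1 + (M.toH X).1 = X := by
  rw [add_comm]
  exact Submodule.projection_add_projection_eq_self M.isCompl X

theorem inner_bracketM (X Y Z : M.m) :
    M.inner (M.bracketM X Y) Z = -M.inner (M.bracketM X Z) Y := by
  rw [eq_neg_iff_add_eq_zero, M.inner_symm (M.bracketM X Z) Y]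
  exact M.inner_bracket X Y Z

section Bracket

variable [FiniteDimensional ℝ E] [LieGroup 𝓘(ℝ, E) ∞ G]

theorem bracketM_swap (X Y : M.m) : M.bracketM Y X = -M.bracketM X Y := by
  rw [bracketM, bracketM, ← lie_skew, toM_eq, map_neg]
  rfl

theorem bracketH_swap (X Y : M.m) : (M.bracketH Y X).1 = -(M.bracketH X Y).1 := by
  rw [bracketH, bracketH, ← lie_skew, toH, map_neg]
  rfl

theorem isLinearMap_bracketM (X : M.m) : IsLinearMap ℝ (M.bracketM X) where
  map_add Y Z := by simp [bracketM, toM_eq]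
  map_smul r Y := by simp [bracketM, toM_eq]

theorem isLinearMap_connectionMap (t : ℝ) (X : M.m) : IsLinearMap ℝ (M.connectionMap t X) where
  map_add Y Z := by simp [connectionMap, (M.isLinearMap_bracketM X).map_add]
  map_smul r Y := by
    rw [connectionMap, (M.isLinearMap_bracketM X).map_smul, smul_comm]
    rfl

theorem isLinearMap_adM (A : isotropyAlgebra E F H) : IsLinearMap ℝ (M.adM A) where
  map_add Y Z := by simp [adM, toM_eq]
  map_smul r Y := by simp [adM, toM_eq]

end Bracket

variable {M} {Q : LinearMap.BilinForm ℝ (GroupLieAlgebra 𝓘(ℝ, E) G)}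

theorem IsInvariantExtension.toM_left (hQ : M.IsInvariantExtension Q)
    (X : GroupLieAlgebra 𝓘(ℝ, E) G) (Y : M.m) : M.inner (M.toM X) Y = Q X Y.1 := by
  conv_rhs => rw [← M.toM_add_toH X]
  rw [map_add, LinearMap.add_apply, hQ.orthogonal _ (M.toH X).2 _ Y.2, add_zero, hQ.restrict]

theorem IsInvariantExtension.toH_right (hQ : M.IsInvariantExtension Q)
    (A : isotropyAlgebra E F H) (X : GroupLieAlgebra 𝓘(ℝ, E) G) :
    Q A.1 (M.toH X).1 = Q A.1 X := by
  conv_rhs => rw [← M.toM_add_toH X]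
  rw [map_add, hQ.orthogonal _ A.2 _ (M.toM X).2, zero_add]

theorem IsInvariantExtension.bracket_apply (hQ : M.IsInvariantExtension Q) (X Y Z W : M.m) :
    Q ⁅X.1, Y.1⁆ ⁅Z.1, W.1⁆ = Q (M.bracketH X Y).1 (M.bracketH Z W).1
      + M.inner (M.bracketM X Y) (M.bracketM Z W) := by
  conv_lhs => rw [← M.toM_add_toH ⁅X.1, Y.1⁆, ← M.toM_add_toH ⁅Z.1, W.1⁆]
  rw [map_add, map_add, LinearMap.add_apply, LinearMap.add_apply,
    hQ.orthogonal _ (M.toH ⁅X.1, Y.1⁆).2 _ (M.toM ⁅Z.1, W.1⁆).2,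
    hQ.symm _ (M.toH ⁅Z.1, W.1⁆).1,
    hQ.orthogonal _ (M.toH ⁅Z.1, W.1⁆).2 _ (M.toM ⁅X.1, Y.1⁆).2, hQ.restrict, bracketH, bracketH,
    bracketM, bracketM]
  ring

variable {n : ℕ} {Z : Module.Basis (Fin n) ℝ M.m}

theorem repr_eq_inner (hZ : ∀ i j, M.inner (Z i) (Z j) = if i = j then 1 else 0) (v : M.m)
    (i : Fin n) : Z.repr v i = M.inner v (Z i) := by
  conv_rhs => rw [← Z.sum_repr v]
  simp only [map_sum, map_smul, LinearMap.sum_apply, LinearMap.smul_apply, hZ, smul_eq_mul,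
    mul_ite, mul_one, mul_zero, Finset.sum_ite_eq', Finset.mem_univ, if_true]

theorem sum_inner_smul (hZ : ∀ i j, M.inner (Z i) (Z j) = if i = j then 1 else 0) (v : M.m) :
    ∑ i, M.inner v (Z i) • Z i = v := by
  simp_rw [← repr_eq_inner hZ]
  exact Z.sum_repr v

theorem inner_eq_sum (hZ : ∀ i j, M.inner (Z i) (Z j) = if i = j then 1 else 0) (v w : M.m) :
    M.inner v w = ∑ i, M.inner v (Z i) * M.inner w (Z i) := by
  conv_lhs => rw [← sum_inner_smul hZ w]
  simp only [map_sum, map_smul, smul_eq_mul, mul_comm]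

theorem cliffordRelations (hZ : ∀ i j, M.inner (Z i) (Z j) = if i = j then 1 else 0) :
    CliffordRelations fun i => M.vec (Z i) := by
  intro i j
  have h := CliffordAlgebra.ι_mul_ι_add_swap (Q := M.cliffordForm) (Z i) (Z j)
  have hp : QuadraticMap.polar M.cliffordForm (Z i) (Z j) = if i = j then -2 else 0 := by
    simp only [QuadraticMap.polar, cliffordForm, neg_apply,
      LinearMap.BilinMap.toQuadraticMap_apply, map_add, LinearMap.add_apply, hZ]
    by_cases hij : i = j
    · simp [hij]; norm_num
    · simp [hij, Ne.symm hij]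
  rw [hp] at h
  rw [eq_sub_of_add_eq h, apply_ite (algebraMap ℝ M.Cl), map_neg, map_ofNat, map_zero]
  split_ifs <;> abel

variable [FiniteDimensional ℝ E] [LieGroup 𝓘(ℝ, E) ∞ G]

/-- Differentiating the `Ad`-invariance of `Q` at the identity. -/
theorem IsInvariantExtension.ad_invariant (hQ : M.IsInvariantExtension Q)
    (X Y Z : GroupLieAlgebra 𝓘(ℝ, E) G) : Q ⁅X, Y⁆ Z + Q Y ⁅X, Z⁆ = 0 := by
  obtain ⟨D, hD, hDX⟩ := exists_hasChartDerivAt_Ad Y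
  obtain ⟨D', hD', hDX'⟩ := exists_hasChartDerivAt_Ad Z
  let B : E →L[ℝ] E →L[ℝ] ℝ := LinearMap.toContinuousBilinearMap
    (Q.compl₁₂ toModel.symm.toLinearMap toModel.symm.toLinearMap)
  have hB : ∀ U V : GroupLieAlgebra 𝓘(ℝ, E) G, B (toModel U) (toModel V) = Q U V := fun U V => rfl
  have h1 := (hD.clm_comp B).clm_apply hD'
  have h2 : (fun g : G => B (toModel (Ad g Y)) (toModel (Ad g Z))) = fun _ => Q Y Z := by
    funext g
    rw [hB, hQ.invariant]
  rw [h2] at h1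
  have h3 : HasChartDerivAt (fun _ : G => Q Y Z) (0 : E →L[ℝ] ℝ) 1 :=
    ⟨continuousAt_const, hasFDerivAt_const _ _⟩
  have h4 := congrArg (fun L : E →L[ℝ] ℝ => L (toModel X)) (h1.unique h3)
  simp only [add_apply, ContinuousLinearMap.comp_apply, ContinuousLinearMap.flip_apply,
    hDX, hDX', Ad_one, hB, zero_apply] at h4
  rw [add_comm]
  exact h4

/-- By the `ad`-invariance of `Q`, the `𝔥`-component of brackets of `𝔪` determines the isotropy
representation. -/
theorem IsInvariantExtension.inner_adM (hQ : M.IsInvariantExtension Q)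
    (A : isotropyAlgebra E F H) (X Y : M.m) :
    M.inner (M.adM A X) Y = Q A.1 (M.bracketH X Y).1 := by
  rw [adM, hQ.toM_left, bracketH, hQ.toH_right, ← lie_skew, map_neg, LinearMap.neg_apply]
  linarith [hQ.ad_invariant X.1 A.1 Y.1]

theorem IsInvariantExtension.inner_adM_swap (hQ : M.IsInvariantExtension Q)
    (A : isotropyAlgebra E F H) (X Y : M.m) :
    M.inner (M.adM A X) Y = -M.inner (M.adM A Y) X := by
  rw [hQ.inner_adM, hQ.inner_adM, M.bracketH_swap Y X, map_neg]

/-- The Jacobi identity, paired with a vector of `𝔪`. -/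
theorem IsInvariantExtension.bianchi (hQ : M.IsInvariantExtension Q) (X Y Z W : M.m) :
    Q ⁅X.1, Y.1⁆ ⁅Z.1, W.1⁆ + Q ⁅Y.1, Z.1⁆ ⁅X.1, W.1⁆ + Q ⁅Z.1, X.1⁆ ⁅Y.1, W.1⁆ = 0 := by
  have h1 := hQ.ad_invariant Z.1 ⁅X.1, Y.1⁆ W.1
  have h2 := hQ.ad_invariant X.1 ⁅Y.1, Z.1⁆ W.1
  have h3 := hQ.ad_invariant Y.1 ⁅Z.1, X.1⁆ W.1
  have h4 := congrArg (fun U => Q U W.1) (lie_jacobi X.1 Y.1 Z.1)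
  simp only [map_add, LinearMap.add_apply, map_zero, LinearMap.zero_apply] at h4
  linarith

/-- The `𝔪`-component of the Jacobi identity. -/
theorem jacH_add_jacM (X Y Z : M.m) : M.jacH X Y Z + M.jacM X Y Z = 0 := by
  have h : ∀ X Y Z : M.m, M.bracketM X (M.bracketM Y Z) + M.toM ⁅X.1, (M.bracketH Y Z).1⁆
      = M.toM ⁅X.1, ⁅Y.1, Z.1⁆⁆ := by
    intro X Y Z
    conv_rhs => rw [← M.toM_add_toH ⁅Y.1, Z.1⁆]
    rw [lie_add, toM_eq, toM_eq, map_add]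
    rfl
  have h0 := congrArg M.toM (lie_jacobi X.1 Y.1 Z.1)
  have h1 := h X Y Z
  have h2 := h Y Z X
  have h3 := h Z X Y
  rw [jacH, jacM]
  simp only [toM_eq, map_add, map_zero] at *
  rw [← h0, ← h1, ← h2, ← h3]
  abel

end Space

end Geometry

/-! ### Lifts to the spin algebra -/

section SpinLift

variable {E : Type*} [NormedAddCommGroup E] [NormedSpace ℝ E]
  {G : Type*} [TopologicalSpace G] [ChartedSpace E G] [Group G]
  {F : Type*} [NormedAddCommGroup F] [NormedSpace ℝ F]
  {H : Subgroup G} [ChartedSpace F H]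

namespace Space

variable {M : Space E F H} {n : ℕ} {Z : Module.Basis (Fin n) ℝ M.m}

theorem mem_even_of_mem_spinAlgebra {a : M.Cl} (ha : a ∈ M.spinAlgebra) :
    a ∈ CliffordAlgebra.even M.cliffordForm := by
  have : M.spinAlgebra ≤ Subalgebra.toSubmodule (CliffordAlgebra.even M.cliffordForm) := by
    refine Submodule.span_le.2 ?_
    rintro _ ⟨v, w, rfl⟩
    exact Submodule.sub_mem _ (CliffordAlgebra.ι_mul_ι_mem_evenOdd_zero _ v w)
      (CliffordAlgebra.ι_mul_ι_mem_evenOdd_zero _ w v)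
  exact this ha

theorem star_of_mem_spinAlgebra {a : M.Cl} (ha : a ∈ M.spinAlgebra) : star a = -a := by
  induction ha using Submodule.span_induction with
  | mem x hx =>
    obtain ⟨v, w, rfl⟩ := hx
    simp only [star_sub, star_mul, CliffordAlgebra.star_ι, neg_mul_neg, neg_sub]
  | zero => simp
  | add x y _ _ hx hy => rw [star_add, hx, hy, neg_add]
  | smul r x _ hx => rw [CliffordAlgebra.star_smul, hx, smul_neg]

/-- The degree two Clifford element whose commutator with vectors is the skew map `A`. -/
def skewElement (Z : Fin n → M.m) (A : M.m → M.m) : M.Cl :=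
  (1 / 4 : ℝ) • ∑ j, ∑ k, M.inner (A (Z j)) (Z k) • (M.vec (Z j) * M.vec (Z k))

theorem skewElement_mem {A : M.m → M.m}
    (hA : ∀ X Y, M.inner (A X) Y = -M.inner (A Y) X) : skewElement Z A ∈ M.spinAlgebra := by
  have h : skewElement Z A = (1 / 8 : ℝ) • ∑ j, ∑ k, M.inner (A (Z j)) (Z k) •
      (M.vec (Z j) * M.vec (Z k) - M.vec (Z k) * M.vec (Z j)) := by
    have h1 : ∑ j, ∑ k, M.inner (A (Z j)) (Z k) • (M.vec (Z k) * M.vec (Z j))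
        = -∑ j, ∑ k, M.inner (A (Z j)) (Z k) • (M.vec (Z j) * M.vec (Z k)) := by
      rw [Finset.sum_comm, ← Finset.sum_neg_distrib]
      refine Finset.sum_congr rfl fun j _ => ?_
      rw [← Finset.sum_neg_distrib]
      refine Finset.sum_congr rfl fun k _ => ?_
      rw [hA, neg_smul]
    simp_rw [smul_sub, Finset.sum_sub_distrib]
    rw [h1, skewElement]
    module
  rw [h]
  exact Submodule.smul_mem _ _ (Submodule.sum_mem _ fun j _ => Submodule.sum_mem _ fun k _ =>
    Submodule.smul_mem _ _ (Submodule.subset_span ⟨_, _, rfl⟩))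

theorem skewElement_commutator (hZ : ∀ i j, M.inner (Z i) (Z j) = if i = j then 1 else 0)
    {A : M.m → M.m} (hlin : IsLinearMap ℝ A)
    (hA : ∀ X Y, M.inner (A X) Y = -M.inner (A Y) X) (v : M.m) :
    skewElement Z A * M.vec v - M.vec v * skewElement Z A = M.vec (A v) := by
  have h := fun q => (cliffordRelations hZ).commutator_degree_two
    (a := fun j k => M.inner (A (Z j)) (Z k)) (fun i j => hA _ _) q
  have hbasis : ∀ q, skewElement Z A * M.vec (Z q) - M.vec (Z q) * skewElement Z A
      = M.vec (A (Z q)) := by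
    intro q
    rw [skewElement, smul_mul_assoc, mul_smul_comm, ← smul_sub, h q, smul_smul]
    conv_rhs => rw [← sum_inner_smul hZ (A (Z q)), vec, map_sum]
    simp_rw [map_smul]
    norm_num
  let L : M.m →ₗ[ℝ] M.Cl := (LinearMap.mulLeft ℝ (skewElement Z A)
    - LinearMap.mulRight ℝ (skewElement Z A)) ∘ₗ CliffordAlgebra.ι M.cliffordForm
  let R : M.m →ₗ[ℝ] M.Cl := CliffordAlgebra.ι M.cliffordForm ∘ₗ hlin.mk' A
  have hLR : L = R := Z.ext fun q => hbasis q
  exact congrArg (fun f : M.m →ₗ[ℝ] M.Cl => f v) hLR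

/-- An element of the even Clifford algebra that is skew for the canonical involution is
determined by its commutators with vectors. -/
theorem eq_skewElement (hZ : ∀ i j, M.inner (Z i) (Z j) = if i = j then 1 else 0)
    {A : M.m → M.m} (hlin : IsLinearMap ℝ A)
    (hA : ∀ X Y, M.inner (A X) Y = -M.inner (A Y) X) {a : M.Cl}
    (hev : a ∈ CliffordAlgebra.even M.cliffordForm) (hstar : star a = -a)
    (ha : ∀ v, a * M.vec v - M.vec v * a = M.vec (A v)) : a = skewElement Z A := by
  rw [← sub_eq_zero]
  have hm := skewElement_mem (Z := Z) hA
  refine eq_zero_of_even_of_commute Z (cliffordRelations hZ)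
    (Subalgebra.sub_mem _ hev (mem_even_of_mem_spinAlgebra hm)) ?_ fun v => ?_
  · rw [star_sub, hstar, star_of_mem_spinAlgebra hm]
    abel
  · rw [← sub_eq_zero, ← sub_eq_zero.2 ((ha v).trans (skewElement_commutator hZ hlin hA v).symm)]
    noncomm_ring

/-- The lift is defined as an inverse image, which exists for skew maps and is unique. -/
theorem spinLift_eq_skewElement (hZ : ∀ i j, M.inner (Z i) (Z j) = if i = j then 1 else 0)
    {A : M.m → M.m} (hlin : IsLinearMap ℝ A)
    (hA : ∀ X Y, M.inner (A X) Y = -M.inner (A Y) X) : M.spinLift A = skewElement Z A := by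
  let Φ : M.spinAlgebra → M.m → M.Cl :=
    fun a v => (a : M.Cl) * M.vec v - M.vec v * (a : M.Cl)
  have hex : ∃ a, Φ a = fun v => M.vec (A v) :=
    ⟨⟨_, skewElement_mem (Z := Z) hA⟩, funext (skewElement_commutator hZ hlin hA)⟩
  have h := Function.invFun_eq hex
  have hm := (Function.invFun Φ fun v => M.vec (A v)).2
  exact eq_skewElement hZ hlin hA (mem_even_of_mem_spinAlgebra hm) (star_of_mem_spinAlgebra hm)
    (congrFun h)

end Space

end SpinLift

/-! ### The differential of a homogeneous spin structure -/

section SpinStructure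

variable {E : Type*} [NormedAddCommGroup E] [NormedSpace ℝ E]
  {G : Type*} [TopologicalSpace G] [ChartedSpace E G] [Group G]
  {F : Type*} [NormedAddCommGroup F] [NormedSpace ℝ F]
  {H : Subgroup G} [ChartedSpace F H]
  {E' : Type*} [NormedAddCommGroup E'] [NormedSpace ℝ E']

/-- The differential of the inclusion of a Lie subgroup. -/
def inclusionDeriv (E : Type*) [NormedAddCommGroup E] [NormedSpace ℝ E]
    {G : Type*} [TopologicalSpace G] [ChartedSpace E G] [Group G]
    (F : Type*) [NormedAddCommGroup F] [NormedSpace ℝ F]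
    (H : Subgroup G) [ChartedSpace F H] : F →L[ℝ] E :=
  mfderiv 𝓘(ℝ, F) 𝓘(ℝ, E) (Subtype.val : H → G) 1

theorem exists_inclusionDeriv_eq (A : isotropyAlgebra E F H) :
    ∃ ξ : F, inclusionDeriv E F H ξ = toModel A.1 := by
  obtain ⟨ξ, hξ⟩ := A.2
  exact ⟨ξ, congrArg toModel hξ⟩

theorem HasChartDerivAt.comp_subgroup (hH : IsClosedLieSubgroup E F H) {u : G → E'}
    {D : E →L[ℝ] E'} (hu : HasChartDerivAt u D 1) :
    HasChartDerivAt (fun h : H => u h) (D.comp (inclusionDeriv E F H)) 1 := by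
  have hv : MDifferentiableAt 𝓘(ℝ, F) 𝓘(ℝ, E) (Subtype.val : H → G) 1 :=
    hH.contMDiff_val.mdifferentiableAt (by simp)
  exact hasChartDerivAt_iff.2
    (HasMFDerivAt.comp (1 : H) (f := (Subtype.val : H → G)) (g := u)
      (hasChartDerivAt_iff.1 hu) hv.hasMFDerivAt)

namespace Space

variable {M : Space E F H}

section FiniteClifford

variable [Module.Finite ℝ M.Cl]

/-- Linear coordinates on the Clifford algebra; they carry the norm used to differentiate maps to
the Clifford algebra. -/
def clCoord (M : Space E F H) [Module.Finite ℝ M.Cl] :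
    M.Cl ≃ₗ[ℝ] (Fin (Module.finrank ℝ M.Cl) → ℝ) :=
  (Module.finBasis ℝ M.Cl).equivFun

/-- The differential at the identity of a homogeneous spin structure. -/
def liftDeriv (S : M.SpinStructure) (ξ : F) : M.Cl :=
  M.clCoord.symm (chartDeriv (fun h : H => M.clCoord (S.lift h : M.Cl)) 1 ξ)

theorem exists_hasChartDerivAt_lift (S : M.SpinStructure) (f : M.Cl →ₗ[ℝ] E') :
    ∃ D : F →L[ℝ] E', HasChartDerivAt (fun h : H => f (S.lift h : M.Cl)) D 1 ∧
      ∀ ξ, D ξ = f (liftDeriv S ξ) := by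
  have h1 : ContMDiff 𝓘(ℝ, F) 𝓘(ℝ, Fin (Module.finrank ℝ M.Cl) → ℝ) ∞
      (fun h : H => M.clCoord (S.lift h : M.Cl)) :=
    contMDiff_pi_space.2 fun i => S.smooth (LinearMap.proj i ∘ₗ M.clCoord.toLinearMap)
  have h2 := (h1.mdifferentiableAt (x := 1) (by simp)).hasChartDerivAt
  have h3 := h2.clm_comp (f ∘ₗ M.clCoord.symm.toLinearMap).toContinuousLinearMap
  refine ⟨_, h3.congr_of_eventuallyEq (Filter.Eventually.of_forall fun h => ?_), fun ξ => rfl⟩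
  simp

/-- The product rule in the Clifford algebra. -/
theorem eq_of_clCoord_mul {u v : H → M.Cl} {a b : F → M.Cl} {Du Dv Dw}
    (hu : HasChartDerivAt (fun h : H => M.clCoord (u h)) Du 1)
    (hv : HasChartDerivAt (fun h : H => M.clCoord (v h)) Dv 1)
    (hw : HasChartDerivAt (fun h : H => M.clCoord (u h * v h)) Dw 1)
    (hDu : ∀ ξ, Du ξ = M.clCoord (a ξ)) (hDv : ∀ ξ, Dv ξ = M.clCoord (b ξ)) (ξ : F) :
    Dw ξ = M.clCoord (u 1 * b ξ + a ξ * v 1) := by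
  let β : (Fin (Module.finrank ℝ M.Cl) → ℝ) →L[ℝ] (Fin (Module.finrank ℝ M.Cl) → ℝ) →L[ℝ]
      (Fin (Module.finrank ℝ M.Cl) → ℝ) := LinearMap.toContinuousBilinearMap
    (((LinearMap.mul ℝ M.Cl).compl₁₂ M.clCoord.symm.toLinearMap
      M.clCoord.symm.toLinearMap).compr₂ M.clCoord.toLinearMap)
  have hβ : ∀ x y : M.Cl, β (M.clCoord x) (M.clCoord y) = M.clCoord (x * y) := fun x y => by
    simp [β]
  have h := (hu.clm_comp β).clm_apply hv
  simp only [hβ] at h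
  have := congrArg (fun L => L ξ) (hw.unique h)
  simpa only [add_apply, ContinuousLinearMap.comp_apply, ContinuousLinearMap.flip_apply, hDu, hDv,
    hβ, ← map_add] using this

/-- A linear functional that vanishes on the even subalgebra, and hence on the spin group, vanishes
on the differential; such functionals separate the subalgebra from its complement. -/
theorem liftDeriv_mem_even (S : M.SpinStructure) (ξ : F) :
    liftDeriv S ξ ∈ CliffordAlgebra.even M.cliffordForm := by
  by_contra hmem
  obtain ⟨f, hf, hle⟩ := Submodule.exists_le_ker_of_notMem
    (p := Subalgebra.toSubmodule (CliffordAlgebra.even M.cliffordForm)) hmem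
  obtain ⟨D, hD, hDξ⟩ := exists_hasChartDerivAt_lift S f
  have h0 : (fun h : H => f (S.lift h : M.Cl)) = fun _ => 0 := by
    funext h
    exact hle (spinGroup.mem_even (S.lift h).2)
  rw [h0] at hD
  have h1 := hD.unique ⟨continuousAt_const, hasFDerivAt_const _ _⟩
  apply hf
  rw [← hDξ, h1]
  rfl

/-- The canonical involution of the Clifford algebra as a linear map. -/
def starLinear (M : Space E F H) : M.Cl →ₗ[ℝ] M.Cl where
  toFun := star
  map_add' := star_add
  map_smul' r x := CliffordAlgebra.star_smul r x

/-- Differentiating the relation `a * star a = 1` of the spin group. -/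
theorem star_liftDeriv (S : M.SpinStructure) (ξ : F) :
    star (liftDeriv S ξ) = -liftDeriv S ξ := by
  obtain ⟨D, hD, hDξ⟩ := exists_hasChartDerivAt_lift S M.clCoord.toLinearMap
  obtain ⟨D', hD', hDξ'⟩ := exists_hasChartDerivAt_lift S
    (M.clCoord.toLinearMap ∘ₗ M.starLinear)
  have hone : ∀ h : H, (S.lift h : M.Cl) * star (S.lift h : M.Cl) = 1 :=
    fun h => spinGroup.mul_star_self_of_mem (S.lift h).2
  have hw : HasChartDerivAt (fun h : H => M.clCoord ((S.lift h : M.Cl) * star (S.lift h : M.Cl)))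
      (0 : F →L[ℝ] _) 1 := by
    simp only [hone]
    exact ⟨continuousAt_const, hasFDerivAt_const _ _⟩
  have h := eq_of_clCoord_mul hD hD' hw hDξ hDξ' ξ
  have h1 : ((S.lift 1 : spinGroup M.cliffordForm) : M.Cl) = 1 := by rw [map_one]; rfl
  have h1' : M.starLinear 1 = 1 := star_one _
  rw [h1, h1', one_mul, mul_one] at h
  have h2 : M.starLinear (liftDeriv S ξ) + liftDeriv S ξ = 0 :=
    M.clCoord.injective (h.symm.trans (map_zero _).symm)
  exact eq_neg_of_add_eq_zero_left h2

variable [FiniteDimensional ℝ E] [LieGroup 𝓘(ℝ, E) ∞ G]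

/-- Differentiating the covering property of a spin structure. -/
theorem liftDeriv_commutator (hH : IsClosedLieSubgroup E F H) (S : M.SpinStructure)
    (A : isotropyAlgebra E F H) {ξ : F} (hξ : inclusionDeriv E F H ξ = toModel A.1) (v : M.m) :
    liftDeriv S ξ * M.vec v - M.vec v * liftDeriv S ξ = M.vec (M.adM A v) := by
  obtain ⟨D, hD, hDξ⟩ := exists_hasChartDerivAt_lift S M.clCoord.toLinearMap
  obtain ⟨D', hD', hDξ'⟩ := exists_hasChartDerivAt_lift S
    (M.clCoord.toLinearMap ∘ₗ LinearMap.mulRight ℝ (M.vec v))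
  obtain ⟨B, hB, hBX⟩ := exists_hasChartDerivAt_Ad v.1
  have hv := (hB.comp_subgroup hH).clm_comp (M.clCoord.toLinearMap ∘ₗ
    CliffordAlgebra.ι M.cliffordForm ∘ₗ M.toMₗ ∘ₗ toModel.symm.toLinearMap).toContinuousLinearMap
  have hv' := hv.congr_of_eventuallyEq
    (h' := fun h : H => M.clCoord (M.vec (M.isotropyRep h v)))
    (Filter.Eventually.of_forall fun h =>
      congrArg (fun w => M.clCoord (M.vec w)) (M.toM_coe (M.isotropyRep h v)).symm)
  have hcov : ∀ h : H, M.vec (M.isotropyRep h v) * (S.lift h : M.Cl)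
      = (S.lift h : M.Cl) * M.vec v := by
    intro h
    rw [← S.covers, mul_assoc]
    have : (((S.lift h)⁻¹ : spinGroup M.cliffordForm) : M.Cl) * (S.lift h : M.Cl) = 1 := by
      rw [← Submonoid.coe_mul, inv_mul_cancel]; rfl
    rw [this, mul_one]
  have hw : HasChartDerivAt (fun h : H => M.clCoord (M.vec (M.isotropyRep h v) *
      (S.lift h : M.Cl))) D' 1 := by
    simp only [hcov]
    exact hD'
  have h := eq_of_clCoord_mul (a := fun ζ => M.vec (M.toM (toModel.symm
    (B (inclusionDeriv E F H ζ))))) hv' hD hw (fun ζ => rfl) hDξ ξ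
  have h1 : ((S.lift 1 : spinGroup M.cliffordForm) : M.Cl) = 1 := by rw [map_one]; rfl
  have h2 : M.isotropyRep 1 v = v := Subtype.ext (Ad_one v.1)
  rw [h1, h2, mul_one, hξ, hBX, LinearEquiv.symm_apply_apply, hDξ'] at h
  have h3 : liftDeriv S ξ * M.vec v
      = M.vec v * liftDeriv S ξ + M.vec (M.toM ⁅A.1, v.1⁆) := M.clCoord.injective h
  rw [h3, adM]
  abel

end FiniteClifford

variable [FiniteDimensional ℝ E] [LieGroup 𝓘(ℝ, E) ∞ G] {n : ℕ} {Z : Module.Basis (Fin n) ℝ M.m}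
  {Q : LinearMap.BilinForm ℝ (GroupLieAlgebra 𝓘(ℝ, E) G)}

theorem adLift_eq (hQ : M.IsInvariantExtension Q)
    (hZ : ∀ i j, M.inner (Z i) (Z j) = if i = j then 1 else 0) (A : isotropyAlgebra E F H) :
    M.adLift A = (1 / 4 : ℝ) • ∑ j, ∑ k, Q A.1 (M.bracketH (Z j) (Z k)).1 •
      (M.vec (Z j) * M.vec (Z k)) := by
  rw [adLift, spinLift_eq_skewElement hZ (M.isLinearMap_adM A) (hQ.inner_adM_swap A),
    skewElement]
  simp_rw [hQ.inner_adM]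

/-- By equivariance, vectors of the isotropy algebra differentiate spinor fields through Clifford
multiplication. -/
theorem leftDeriv_isotropy (hH : IsClosedLieSubgroup E F H) (hQ : M.IsInvariantExtension Q)
    (hZ : ∀ i j, M.inner (Z i) (Z j) = if i = j then 1 else 0) (S : M.SpinStructure)
    {Δ : Type*} [NormedAddCommGroup Δ] [NormedSpace ℂ Δ]
    (c : M.Cl →ₐ[ℝ] Module.End ℂ Δ) {ψ : G → Δ} (hψ : M.IsSpinorField S c ψ)
    (A : isotropyAlgebra E F H) (g : G) :
    leftDeriv A.1 ψ g = -c (M.adLift A) (ψ g) := by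
  have : Module.Finite ℝ M.Cl := finite_cliffordAlgebra Z (cliffordRelations hZ)
  obtain ⟨ξ, hξ⟩ := exists_inclusionDeriv_eq A
  have hlift : liftDeriv S ξ = M.adLift A := by
    rw [adLift, spinLift_eq_skewElement hZ (M.isLinearMap_adM A) (hQ.inner_adM_swap A)]
    exact eq_skewElement hZ (M.isLinearMap_adM A) (hQ.inner_adM_swap A) (liftDeriv_mem_even S ξ)
      (star_liftDeriv S ξ) (liftDeriv_commutator hH S A hξ)
  have hd : MDifferentiableAt 𝓘(ℝ, E) 𝓘(ℝ, Δ) (fun y => ψ (g * y)) 1 :=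
    (contMDiff_comp_mul_left hψ.contMDiff g).mdifferentiableAt (by simp)
  have h1 := hd.hasChartDerivAt.comp_subgroup hH
  -- along `H` the spinor field is `star` of the lift, the inverse in the spin group, applied to `ψ g`
  let f : M.Cl →ₗ[ℝ] Δ :=
    { toFun := fun x => c (star x) (ψ g)
      map_add' := fun x y => by rw [star_add, map_add, LinearMap.add_apply]
      map_smul' := fun r x => by
        rw [CliffordAlgebra.star_smul, map_smul, LinearMap.smul_apply, RingHom.id_apply] }
  obtain ⟨D, hD, hDξ⟩ := exists_hasChartDerivAt_lift S f
  have heq : (fun h : H => ψ (g * h)) = fun h : H => f (S.lift h : M.Cl) := by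
    funext h
    rw [hψ.equivariant, map_inv, ← spinGroup.star_eq_inv]
    rfl
  rw [heq] at h1
  have h2 := congrArg (fun L : F →L[ℝ] Δ => L ξ) (h1.unique hD)
  simp only [ContinuousLinearMap.comp_apply, hξ, hDξ, hlift] at h2
  rw [leftDeriv_eq_chartDeriv (hψ.contMDiff.mdifferentiableAt (by simp)), h2]
  change c (star (M.adLift A)) (ψ g) = _
  rw [← hlift, star_liftDeriv, map_neg, LinearMap.neg_apply]

end Space

end SpinStructure

/-! ### Calculus of left-invariant derivatives -/

section LeftDeriv

variable {E : Type*} [NormedAddCommGroup E] [NormedSpace ℝ E]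
  {G : Type*} [TopologicalSpace G] [ChartedSpace E G]
  {E' : Type*} [NormedAddCommGroup E'] [NormedSpace ℝ E'] {g : G}

theorem HasChartDerivAt.add {f f' : G → E'} {D D' : E →L[ℝ] E'} (hf : HasChartDerivAt f D g)
    (hf' : HasChartDerivAt f' D' g) : HasChartDerivAt (fun y => f y + f' y) (D + D') g :=
  ⟨hf.1.add hf'.1, hf.2.add hf'.2⟩

theorem HasChartDerivAt.sum {n : ℕ} {f : Fin n → G → E'} {D : Fin n → E →L[ℝ] E'}
    (hf : ∀ i, HasChartDerivAt (f i) (D i) g) :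
    HasChartDerivAt (fun y => ∑ i, f i y) (∑ i, D i) g :=
  ⟨tendsto_finsetSum _ fun i _ => (hf i).1, HasFDerivAt.fun_sum fun i _ => (hf i).2⟩

variable [Group G]

theorem HasChartDerivAt.leftDeriv_eq {f : G → E'} {D : E →L[ℝ] E'} (hf : HasChartDerivAt f D g)
    (X : GroupLieAlgebra 𝓘(ℝ, E) G) : leftDeriv X f g = D (mulInvariantVectorField X g) := by
  rw [leftDeriv, (hasChartDerivAt_iff.1 hf).mfderiv]
  rfl

variable [LieGroup 𝓘(ℝ, E) ∞ G]

theorem leftDeriv_add_left {f : G → E'} (hf : MDifferentiableAt 𝓘(ℝ, E) 𝓘(ℝ, E') f g)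
    (X Y : GroupLieAlgebra 𝓘(ℝ, E) G) :
    leftDeriv (X + Y) f g = leftDeriv X f g + leftDeriv Y f g := by
  rw [leftDeriv_eq_chartDeriv hf, leftDeriv_eq_chartDeriv hf, leftDeriv_eq_chartDeriv hf,
    map_add, map_add]

theorem leftDeriv_sum_smul_left {f : G → E'} (hf : MDifferentiableAt 𝓘(ℝ, E) 𝓘(ℝ, E') f g)
    {n : ℕ} (r : Fin n → ℝ) (X : Fin n → GroupLieAlgebra 𝓘(ℝ, E) G) :
    leftDeriv (∑ i, r i • X i) f g = ∑ i, r i • leftDeriv (X i) f g := by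
  simp_rw [leftDeriv_eq_chartDeriv hf, map_sum, map_smul]

end LeftDeriv

namespace Space

variable {E : Type*} [NormedAddCommGroup E] [NormedSpace ℝ E]
  {G : Type*} [TopologicalSpace G] [ChartedSpace E G] [Group G]
  {F : Type*} [NormedAddCommGroup F] [NormedSpace ℝ F]
  {H : Subgroup G} [ChartedSpace F H] {M : Space E F H}
  {n : ℕ} {Z : Module.Basis (Fin n) ℝ M.m} {Q : LinearMap.BilinForm ℝ (GroupLieAlgebra 𝓘(ℝ, E) G)}

/-! ### The structure tensors of a naturally reductive space -/

section Tensors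

/-- The tensor `⟨[Zᵢ, Zⱼ]_𝔪, Zₖ⟩`: up to sign, the torsion of the canonical connection `∇⁰`. -/
def torsionTensor (Z : Fin n → M.m) (i j k : Fin n) : ℝ := M.inner (M.bracketM (Z i) (Z j)) (Z k)

/-- The tensor `Q([Zᵢ, Zⱼ]_𝔥, [Zₖ, Zₗ]_𝔥)`. -/
def isotropyTensor (Q : LinearMap.BilinForm ℝ (GroupLieAlgebra 𝓘(ℝ, E) G)) (Z : Fin n → M.m)
    (i j k l : Fin n) : ℝ :=
  Q (M.bracketH (Z i) (Z j)).1 (M.bracketH (Z k) (Z l)).1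

theorem torsionTensor_swap_right (i j k : Fin n) :
    torsionTensor (M := M) Z i k j = -torsionTensor (M := M) Z i j k :=
  M.inner_bracketM _ _ _

theorem inner_bracketM_eq_wedgeSquare
    (hZ : ∀ i j, M.inner (Z i) (Z j) = if i = j then 1 else 0) (i j k l : Fin n) :
    M.inner (M.bracketM (Z i) (Z j)) (M.bracketM (Z k) (Z l))
      = wedgeSquare (torsionTensor (M := M) Z) i j k l :=
  inner_eq_sum hZ _ _

theorem sumQH_eq : M.sumQH Q Z = ∑ i, ∑ j, isotropyTensor (M := M) Q Z i j i j := rfl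

theorem sumQM_eq (hQ : M.IsInvariantExtension Q)
    (hZ : ∀ i j, M.inner (Z i) (Z j) = if i = j then 1 else 0) :
    M.sumQM Q Z = ∑ i, ∑ j, wedgeSquare (torsionTensor (M := M) Z) i j i j := by
  rw [sumQM]
  simp_rw [hQ.restrict, inner_bracketM_eq_wedgeSquare hZ]

variable [FiniteDimensional ℝ E] [LieGroup 𝓘(ℝ, E) ∞ G]

theorem torsionTensor_swap_left (i j k : Fin n) :
    torsionTensor (M := M) Z j i k = -torsionTensor (M := M) Z i j k := by
  rw [torsionTensor, bracketM_swap, map_neg, LinearMap.neg_apply]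
  rfl

theorem torsionTensor_cyclic (i j k : Fin n) :
    torsionTensor (M := M) Z i j k = torsionTensor (M := M) Z k i j := by
  rw [torsionTensor_swap_right i k j, torsionTensor_swap_left k i j, neg_neg]

theorem isCurvatureLike_isotropyTensor (hQ : M.IsInvariantExtension Q) :
    IsCurvatureLike (isotropyTensor (M := M) Q Z) where
  antisymm i j k l := by
    rw [isotropyTensor, bracketH_swap, map_neg, LinearMap.neg_apply]
    rfl
  pair_symm i j k l := hQ.symm _ _

/-- The tensor `Q([Zᵢ, Zⱼ], [Zₖ, Zₗ])` satisfies the first Bianchi identity. -/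
theorem bianchi_isotropyTensor_add_wedgeSquare (hQ : M.IsInvariantExtension Q)
    (hZ : ∀ i j, M.inner (Z i) (Z j) = if i = j then 1 else 0) (i j k l : Fin n) :
    (isotropyTensor (M := M) Q Z i j k l + wedgeSquare (torsionTensor (M := M) Z) i j k l)
      + (isotropyTensor (M := M) Q Z j k i l + wedgeSquare (torsionTensor (M := M) Z) j k i l)
      + (isotropyTensor (M := M) Q Z k i j l + wedgeSquare (torsionTensor (M := M) Z) k i j l)
      = 0 := by
  simp_rw [← inner_bracketM_eq_wedgeSquare hZ, isotropyTensor, ← hQ.bracket_apply]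
  exact hQ.bianchi _ _ _ _

/-- The square of the cubic Clifford element of the torsion: by the Bianchi identity its part of
degree four is that of the isotropy tensor. -/
theorem cubicSum_torsionTensor_mul_self (hQ : M.IsInvariantExtension Q)
    (hZ : ∀ i j, M.inner (Z i) (Z j) = if i = j then 1 else 0) :
    cubicSum (fun i => M.vec (Z i)) (torsionTensor (M := M) Z)
        * cubicSum (fun i => M.vec (Z i)) (torsionTensor (M := M) Z)
      = (9 : ℝ) • quadSum (fun i => M.vec (Z i)) (isotropyTensor (M := M) Q Z)
        + (18 * M.sumQH Q Z + 6 * M.sumQM Q Z) • (1 : M.Cl) := by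
  rw [sumQH_eq, sumQM_eq hQ hZ]
  exact (cliffordRelations hZ).cubicSum_mul_self_of_bianchi torsionTensor_swap_left
    torsionTensor_swap_right (isCurvatureLike_isotropyTensor hQ)
    (bianchi_isotropyTensor_add_wedgeSquare hQ hZ)

/-- The scalar curvature of the connection `∇^t`. -/
theorem scal_eq (hQ : M.IsInvariantExtension Q) (t : ℝ) :
    M.scal Z t = M.sumQH Q Z + (t - t ^ 2) * M.sumQM Q Z := by
  have h : ∀ i j, M.inner (M.curvature t (Z j) (Z i) (Z i)) (Z j)
      = Q (M.bracketH (Z j) (Z i)).1 (M.bracketH (Z j) (Z i)).1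
        + (t - t ^ 2) * Q (M.bracketM (Z j) (Z i)).1 (M.bracketM (Z j) (Z i)).1 := by
    intro i j
    have h0 : ∀ X : M.m, M.bracketM X X = 0 := fun X => by
      rw [bracketM, lie_self, toM_eq, map_zero]
    have h1 : M.inner (M.bracketM (Z i) (M.bracketM (Z j) (Z i))) (Z j)
        = M.inner (M.bracketM (Z j) (Z i)) (M.bracketM (Z j) (Z i)) := by
      rw [M.inner_bracketM, M.bracketM_swap (Z j) (Z i), map_neg, LinearMap.neg_apply, neg_neg]
    have h2 : M.inner (M.bracketM (M.bracketM (Z j) (Z i)) (Z i)) (Z j)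
        = -M.inner (M.bracketM (Z j) (Z i)) (M.bracketM (Z j) (Z i)) := by
      rw [M.bracketM_swap (Z i), map_neg, LinearMap.neg_apply, h1]
    simp only [curvature, connectionMap, h0, smul_zero, (M.isLinearMap_bracketM _).map_smul,
      (M.isLinearMap_bracketM _).map_zero, map_sub, map_smul, map_zero, LinearMap.sub_apply,
      LinearMap.smul_apply, LinearMap.zero_apply, h1, h2, hQ.inner_adM, smul_eq_mul, hQ.restrict,
      M.bracketH_swap (Z j) (Z i), map_neg]
    ring
  rw [scal, sumQH, sumQM]
  simp_rw [ricci, h, Finset.sum_add_distrib, Finset.mul_sum]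

theorem degreeFourTerm_third : M.degreeFourTerm Z (1 / 3) = 0 := by
  have h : ∀ X Y W : M.m, M.jacH X Y W + (9 * (1 / 3 : ℝ) ^ 2) • M.jacM X Y W = 0 := by
    intro X Y W
    rw [← jacH_add_jacM X Y W]
    norm_num
  simp only [degreeFourTerm, h, map_zero, zero_smul, ite_self, Finset.sum_const_zero, smul_zero]

end Tensors

/-! ### Clifford elements of the isotropy representation -/

section Isotropy

/-- The expansion of `Q` on `𝔥` in a pair of dual bases. -/
theorem sum_dual_bases {r : ℕ} {X Y : Module.Basis (Fin r) ℝ (isotropyAlgebra E F H)}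
    (hXY : ∀ i j, Q (X i).1 (Y j).1 = if i = j then 1 else 0) (A B : isotropyAlgebra E F H) :
    ∑ a, Q (X a).1 A.1 * Q (Y a).1 B.1 = Q A.1 B.1 := by
  have h := congrArg Subtype.val (Y.sum_repr A)
  simp only [AddSubmonoidClass.coe_finsetSum, SetLike.val_smul] at h
  have hA : ∀ b, Q (X b).1 A.1 = Y.repr A b := by
    intro b
    rw [← h]
    simp only [map_sum, map_smul, hXY, smul_eq_mul, mul_ite, mul_one, mul_zero,
      Finset.sum_ite_eq, Finset.mem_univ, if_true]
  conv_rhs => rw [← h]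
  simp only [hA, map_sum, map_smul, LinearMap.sum_apply, LinearMap.smul_apply, smul_eq_mul]

variable [FiniteDimensional ℝ E] [LieGroup 𝓘(ℝ, E) ∞ G]

theorem sum_vec_mul_adLift (hQ : M.IsInvariantExtension Q)
    (hZ : ∀ i j, M.inner (Z i) (Z j) = if i = j then 1 else 0) :
    ∑ i, ∑ j, M.vec (Z i) * M.vec (Z j) * M.adLift (M.bracketH (Z i) (Z j))
      = (1 / 4 : ℝ) • quadSum (fun i => M.vec (Z i)) (isotropyTensor (M := M) Q Z) := by
  simp_rw [adLift_eq hQ hZ, mul_smul_comm, Finset.mul_sum, mul_smul_comm, ← Finset.smul_sum,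
    ← mul_assoc]
  rfl

theorem casimirH_eq (hQ : M.IsInvariantExtension Q)
    (hZ : ∀ i j, M.inner (Z i) (Z j) = if i = j then 1 else 0) {r : ℕ}
    {X Y : Module.Basis (Fin r) ℝ (isotropyAlgebra E F H)}
    (hXY : ∀ i j, Q (X i).1 (Y j).1 = if i = j then 1 else 0) :
    M.casimirH X Y
      = -((1 / 16 : ℝ) • quadSum (fun i => M.vec (Z i)) (isotropyTensor (M := M) Q Z)) := by
  have h : ∀ A : isotropyAlgebra E F H, ∑ a, Q (X a).1 A.1 • M.adLift (Y a) = M.adLift A := by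
    intro A
    simp_rw [adLift_eq hQ hZ, ← sum_dual_bases hXY A]
    simp_rw [Finset.sum_smul, smul_comm _ (1 / 4 : ℝ), ← Finset.smul_sum]
    congr 1
    simp_rw [Finset.smul_sum, smul_smul]
    rw [Finset.sum_comm]
    exact Finset.sum_congr rfl fun i _ => Finset.sum_comm
  rw [casimirH]
  congr 1
  have h2 : ∀ a, M.adLift (X a) * M.adLift (Y a) = (1 / 4 : ℝ) • ∑ i, ∑ j,
      M.vec (Z i) * M.vec (Z j) * Q (X a).1 (M.bracketH (Z i) (Z j)).1 • M.adLift (Y a) := by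
    intro a
    rw [adLift_eq hQ hZ (X a), smul_mul_assoc]
    simp_rw [Finset.sum_mul, smul_mul_assoc, mul_smul_comm]
  simp_rw [h2, ← Finset.smul_sum]
  rw [Finset.sum_comm]
  simp_rw [fun i => Finset.sum_comm (s := (Finset.univ : Finset (Fin r)))
    (t := (Finset.univ : Finset (Fin n))) (f := fun a j => M.vec (Z i) * M.vec (Z j) *
      Q (X a).1 (M.bracketH (Z i) (Z j)).1 • M.adLift (Y a)), ← Finset.mul_sum, h]
  rw [sum_vec_mul_adLift hQ hZ, smul_smul]
  norm_num

theorem sum_vec_mul_spinLift_connectionMap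
    (hZ : ∀ i j, M.inner (Z i) (Z j) = if i = j then 1 else 0) (t : ℝ) :
    ∑ i, M.vec (Z i) * M.spinLift (M.connectionMap t (Z i))
      = (t / 4) • cubicSum (fun i => M.vec (Z i)) (torsionTensor (M := M) Z) := by
  have hA : ∀ i X Y, M.inner (M.connectionMap t (Z i) X) Y
      = -M.inner (M.connectionMap t (Z i) Y) X := by
    intro i X Y
    rw [connectionMap, connectionMap, map_smul, map_smul, LinearMap.smul_apply,
      LinearMap.smul_apply, M.inner_bracketM, smul_neg]
  simp_rw [fun i => spinLift_eq_skewElement hZ (M.isLinearMap_connectionMap t (Z i)) (hA i),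
    skewElement, connectionMap, map_smul, LinearMap.smul_apply, smul_assoc, ← Finset.smul_sum,
    mul_smul_comm, ← Finset.smul_sum, cubicSum, Finset.mul_sum, mul_smul_comm, mul_assoc,
    smul_smul]
  rw [mul_comm, mul_one_div]
  rfl

end Isotropy

end Space

namespace Space

variable {E : Type*} [NormedAddCommGroup E] [NormedSpace ℝ E]
  {G : Type*} [TopologicalSpace G] [ChartedSpace E G] [Group G]
  {F : Type*} [NormedAddCommGroup F] [NormedSpace ℝ F]
  {H : Subgroup G} [ChartedSpace F H] {M : Space E F H}
  {n : ℕ} {Z : Module.Basis (Fin n) ℝ M.m} {Q : LinearMap.BilinForm ℝ (GroupLieAlgebra 𝓘(ℝ, E) G)}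

/-! ### The square of the Dirac operator -/

section Dirac

variable {Δ : Type*} [NormedAddCommGroup Δ] [NormedSpace ℂ Δ] (c : M.Cl →ₐ[ℝ] Module.End ℂ Δ)

theorem hasChartDerivAt_clifford {φ : G → Δ} {g : G}
    [FiniteDimensional ℂ Δ] (hφ : MDifferentiableAt 𝓘(ℝ, E) 𝓘(ℝ, Δ) φ g) (a : M.Cl) :
    ∃ D : E →L[ℝ] Δ, HasChartDerivAt (fun y => c a (φ y)) D g ∧
      ∀ X, D (mulInvariantVectorField X g) = c a (leftDeriv X φ g) := by
  have : FiniteDimensional ℝ Δ := FiniteDimensional.complexToReal Δ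
  let L : Δ →L[ℝ] Δ := ((c a).restrictScalars ℝ).toContinuousLinearMap
  refine ⟨_, hφ.hasChartDerivAt.clm_comp L, fun X => ?_⟩
  rw [hφ.hasChartDerivAt.leftDeriv_eq]
  rfl

/-- The second-order part of the square of the Dirac operator: symmetric second derivatives
give the Laplacian, and antisymmetric ones give brackets. -/
theorem sum_clifford_second_order
    (hZ : ∀ i j, M.inner (Z i) (Z j) = if i = j then 1 else 0) (d : Fin n → Fin n → Δ) :
    ∑ i, ∑ j, c (M.vec (Z i) * M.vec (Z j)) (d i j)
      = -∑ i, d i i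
        + (1 / 2 : ℝ) • ∑ i, ∑ j, c (M.vec (Z i) * M.vec (Z j)) (d i j - d j i) := by
  have h : ∑ i, ∑ j, c (M.vec (Z i) * M.vec (Z j)) (d j i)
      = -∑ i, ∑ j, c (M.vec (Z i) * M.vec (Z j)) (d i j) - (2 : ℝ) • ∑ i, d i i := by
    rw [Finset.sum_comm, ← Finset.sum_neg_distrib, Finset.smul_sum, ← Finset.sum_sub_distrib]
    refine Finset.sum_congr rfl fun i _ => ?_
    have h1 : ∀ j, c (M.vec (Z j) * M.vec (Z i)) (d i j)
        = -c (M.vec (Z i) * M.vec (Z j)) (d i j) - if j = i then (2 : ℝ) • d i j else 0 := by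
      intro j
      rw [show M.vec (Z j) * M.vec (Z i) = _ from cliffordRelations hZ j i, map_sub, map_neg,
        LinearMap.sub_apply, LinearMap.neg_apply]
      split_ifs
      · rw [map_ofNat, two_smul]
        simp [← one_add_one_eq_two]
      · rw [map_zero, LinearMap.zero_apply]
    simp_rw [h1, Finset.sum_sub_distrib, Finset.sum_neg_distrib, Finset.sum_ite_eq',
      Finset.mem_univ, if_true]
  simp_rw [map_sub, Finset.sum_sub_distrib]
  rw [h]
  module

variable [FiniteDimensional ℝ E] [LieGroup 𝓘(ℝ, E) ∞ G]

/-- The Dirac operator of `∇^t` differs from that of the canonical connection by Clifford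
multiplication with the cubic element of the torsion. -/
theorem dirac_eq (hZ : ∀ i j, M.inner (Z i) (Z j) = if i = j then 1 else 0) (t : ℝ) (φ : G → Δ)
    (g : G) :
    M.dirac c Z t φ g = ∑ i, c (M.vec (Z i)) (leftDeriv (Z i).1 φ g)
      + (t / 4) • c (cubicSum (fun i => M.vec (Z i)) (torsionTensor (M := M) Z)) (φ g) := by
  have h := congrArg (fun a => c a (φ g)) (sum_vec_mul_spinLift_connectionMap hZ t)
  simp only [map_sum, map_mul, map_smul, LinearMap.sum_apply, LinearMap.smul_apply,
    Module.End.mul_apply] at h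
  rw [dirac, ← h, ← Finset.sum_add_distrib]
  simp_rw [covDeriv, map_add]

/-- The derivative of a spinor field along a bracket of vectors of `𝔪`: only the `𝔪`-component of
the bracket differentiates. -/
theorem leftDeriv_bracket (hH : IsClosedLieSubgroup E F H) (hQ : M.IsInvariantExtension Q)
    (hZ : ∀ i j, M.inner (Z i) (Z j) = if i = j then 1 else 0) (S : M.SpinStructure)
    {ψ : G → Δ} (hψ : M.IsSpinorField S c ψ) (i j : Fin n) (g : G) :
    leftDeriv (⁅(Z i).1, (Z j).1⁆ : GroupLieAlgebra 𝓘(ℝ, E) G) ψ g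
      = ∑ k, torsionTensor (M := M) Z i j k • leftDeriv (Z k).1 ψ g
        - c (M.adLift (M.bracketH (Z i) (Z j))) (ψ g) := by
  have hd : MDifferentiableAt 𝓘(ℝ, E) 𝓘(ℝ, Δ) ψ g := hψ.contMDiff.mdifferentiableAt (by simp)
  have h := congrArg Subtype.val (sum_inner_smul hZ (M.bracketM (Z i) (Z j)))
  simp only [AddSubmonoidClass.coe_finsetSum, SetLike.val_smul] at h
  rw [← M.toM_add_toH ⁅(Z i).1, (Z j).1⁆, leftDeriv_add_left hd,
    leftDeriv_isotropy hH hQ hZ S c hψ, ← sub_eq_add_neg]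
  congr 1
  rw [← leftDeriv_sum_smul_left hd]
  exact congrArg (fun V => leftDeriv V ψ g) h.symm

variable [FiniteDimensional ℂ Δ]

theorem leftDeriv_dirac (hZ : ∀ i j, M.inner (Z i) (Z j) = if i = j then 1 else 0) (t : ℝ)
    {ψ : G → Δ} (hψ : ContMDiff 𝓘(ℝ, E) 𝓘(ℝ, Δ) ∞ ψ) (g : G)
    (X : GroupLieAlgebra 𝓘(ℝ, E) G) :
    leftDeriv X (M.dirac c Z t ψ) g
      = ∑ i, c (M.vec (Z i)) (leftDeriv X (leftDeriv (Z i).1 ψ) g)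
        + (t / 4) • c (cubicSum (fun i => M.vec (Z i)) (torsionTensor (M := M) Z))
          (leftDeriv X ψ g) := by
  choose D hD hDX using fun i =>
    hasChartDerivAt_clifford c (mdifferentiableAt_leftDeriv hψ g (Z i).1) (M.vec (Z i))
  obtain ⟨D', hD', hDX'⟩ := hasChartDerivAt_clifford c (hψ.mdifferentiableAt (by simp))
    ((t / 4) • cubicSum (fun i => M.vec (Z i)) (torsionTensor (M := M) Z))
  have h := (HasChartDerivAt.sum hD).add hD'
  have heq : M.dirac c Z t ψ = fun y => ∑ i, c (M.vec (Z i)) (leftDeriv (Z i).1 ψ y)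
      + c ((t / 4) • cubicSum (fun i => M.vec (Z i)) (torsionTensor (M := M) Z)) (ψ y) := by
    funext y
    rw [dirac_eq c hZ, map_smul, LinearMap.smul_apply]
  have hX : leftDeriv X (M.dirac c Z t ψ) g
      = (∑ i, D i) (mulInvariantVectorField X g) + D' (mulInvariantVectorField X g) := by
    rw [heq, h.leftDeriv_eq]
    rfl
  rw [hX, hDX', map_smul, LinearMap.smul_apply]
  congr 1
  exact (sum_apply _ _ _).trans (Finset.sum_congr rfl fun i _ => hDX i X)

/-- The square of the Dirac operator for `t = 1/3`, the value for which the first-order terms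
cancel. -/
theorem dirac_dirac_third (hH : IsClosedLieSubgroup E F H) (hQ : M.IsInvariantExtension Q)
    (hZ : ∀ i j, M.inner (Z i) (Z j) = if i = j then 1 else 0) (S : M.SpinStructure)
    {r : ℕ} {X Y : Module.Basis (Fin r) ℝ (isotropyAlgebra E F H)}
    (hXY : ∀ i j, Q (X i).1 (Y j).1 = if i = j then 1 else 0)
    {ψ : G → Δ} (hψ : M.IsSpinorField S c ψ) (g : G) :
    M.dirac c Z (1 / 3) (M.dirac c Z (1 / 3) ψ) g = M.casimirG c Z X Y ψ g
      + ((1 / 8 : ℝ) * (M.sumQH Q Z + (1 / 3) * M.sumQM Q Z)) • ψ g := by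
  set e : Fin n → M.Cl := fun i => M.vec (Z i) with he
  set T := torsionTensor (M := M) Z with hT
  set R := isotropyTensor (M := M) Q Z with hR
  have hrel : CliffordRelations e := cliffordRelations hZ
  -- the first-order part
  have h1 : ∑ i, c (e i) (c (cubicSum e T) (leftDeriv (Z i).1 ψ g))
      + c (cubicSum e T) (∑ i, c (e i) (leftDeriv (Z i).1 ψ g))
      = -((6 : ℝ) • ∑ k, c (slice e T k) (leftDeriv (Z k).1 ψ g)) := by
    rw [map_sum, ← Finset.sum_add_distrib, Finset.smul_sum, ← Finset.sum_neg_distrib]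
    refine Finset.sum_congr rfl fun k _ => ?_
    rw [← Module.End.mul_apply, ← Module.End.mul_apply, ← map_mul, ← map_mul,
      ← LinearMap.add_apply, ← map_add, hrel.anticommutator_cubicSum torsionTensor_swap_left
        torsionTensor_swap_right, map_neg, map_smul]
    rfl
  -- the second-order part
  have h2 : ∑ i, ∑ j, c (e i * e j) (leftDeriv (Z i).1 (leftDeriv (Z j).1 ψ) g)
      = -∑ i, leftDeriv (Z i).1 (leftDeriv (Z i).1 ψ) g
        + (1 / 2 : ℝ) • (∑ k, c (slice e T k) (leftDeriv (Z k).1 ψ g)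
          - c ((1 / 4 : ℝ) • quadSum e R) (ψ g)) := by
    rw [sum_clifford_second_order c hZ, ← sum_vec_mul_adLift hQ hZ]
    simp_rw [leftDeriv_comm hψ.contMDiff, leftDeriv_bracket c hH hQ hZ S hψ, map_sub,
      Finset.sum_sub_distrib, map_sum, LinearMap.sum_apply]
    congr 3
    · simp_rw [slice, map_sum, LinearMap.sum_apply]
      rw [← sum_cyclic]
      refine Finset.sum_congr rfl fun k _ => Finset.sum_congr rfl fun i _ =>
        Finset.sum_congr rfl fun j _ => ?_
      rw [hT, torsionTensor_cyclic i j k, map_smul c, LinearMap.map_smul_of_tower]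
      rfl
    · simp_rw [map_mul, Module.End.mul_apply]
  -- the part of order zero
  have h3 : c (cubicSum e T) (c (cubicSum e T) (ψ g)) = (9 : ℝ) • c (quadSum e R) (ψ g)
      + (18 * M.sumQH Q Z + 6 * M.sumQM Q Z) • ψ g := by
    rw [← Module.End.mul_apply, ← map_mul, he, hT, cubicSum_torsionTensor_mul_self hQ hZ, map_add,
      map_smul, map_smul, map_one]
    rfl
  have h0 : M.dirac c Z (1 / 3) (M.dirac c Z (1 / 3) ψ) g
      = ∑ i, ∑ j, c (e i * e j) (leftDeriv (Z i).1 (leftDeriv (Z j).1 ψ) g)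
        + (1 / 12 : ℝ) • (∑ i, c (e i) (c (cubicSum e T) (leftDeriv (Z i).1 ψ g))
          + c (cubicSum e T) (∑ i, c (e i) (leftDeriv (Z i).1 ψ g)))
        + (1 / 144 : ℝ) • c (cubicSum e T) (c (cubicSum e T) (ψ g)) := by
    rw [dirac_eq c hZ, dirac_eq c hZ (1 / 3) ψ g]
    simp_rw [leftDeriv_dirac c hZ _ hψ.contMDiff, map_add, Finset.sum_add_distrib,
      LinearMap.map_smul_of_tower, ← Finset.smul_sum, map_mul, Module.End.mul_apply, map_sum]
    module
  rw [h0, h1, h2, h3, casimirG, casimirH_eq hQ hZ hXY, map_neg, map_smul, map_smul]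
  simp only [LinearMap.neg_apply, LinearMap.smul_apply]
  module

end Dirac

end Space

end NaturallyReductive

end

theorem mainTheorem2
    {E : Type*} [NormedAddCommGroup E] [NormedSpace ℝ E] [FiniteDimensional ℝ E]
    {G : Type*} [TopologicalSpace G] [ChartedSpace E G] [Group G] [LieGroup 𝓘(ℝ, E) ∞ G]
    {F : Type*} [NormedAddCommGroup F] [NormedSpace ℝ F] [FiniteDimensional ℝ F]
    {H : Subgroup G} [ChartedSpace F H] [LieGroup 𝓘(ℝ, F) ∞ H]
    (hH : NaturallyReductive.IsClosedLieSubgroup E F H)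
    (M : NaturallyReductive.Space E F H)
    (Q : LinearMap.BilinForm ℝ (GroupLieAlgebra 𝓘(ℝ, E) G)) (hQ : M.IsInvariantExtension Q)
    (S : M.SpinStructure)
    {Δ : Type*} [NormedAddCommGroup Δ] [NormedSpace ℂ Δ] [FiniteDimensional ℂ Δ]
    (c : M.Cl →ₐ[ℝ] Module.End ℂ Δ) (hc : M.IsSpinModule c)
    {n : ℕ} (hn : n = 3 ∨ 5 ≤ n)
    (Z : Module.Basis (Fin n) ℝ M.m)
    (hZ : ∀ i j, M.inner (Z i) (Z j) = if i = j then 1 else 0)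
    {r : ℕ} (X Y : Module.Basis (Fin r) ℝ (NaturallyReductive.isotropyAlgebra E F H))
    (hXY : ∀ i j, Q (X i).1 (Y j).1 = if i = j then 1 else 0)
    (ψ : G → Δ) (hψ : M.IsSpinorField S c ψ) :
    -- the first order and the degree four terms vanish for `t = 1/3`
    (∀ g, M.firstOrderTerm c Z (1 / 3) ψ g = 0) ∧
    M.degreeFourTerm Z (1 / 3) = 0 ∧
    -- the square of the Dirac operator
    (∀ g, M.dirac c Z (1 / 3) (M.dirac c Z (1 / 3) ψ) g =
      M.casimirG c Z X Y ψ g +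
        ((1 / 8 : ℝ) * (M.sumQH Q Z + (1 / 3) * M.sumQM Q Z)) • ψ g) ∧
    (∀ g, M.dirac c Z (1 / 3) (M.dirac c Z (1 / 3) ψ) g =
      M.casimirG c Z X Y ψ g +
        ((1 / 8 : ℝ) * (M.scal Z (1 / 3) + (1 / 9) * M.sumQM Q Z)) • ψ g) ∧
    -- the symmetric case `[𝔪, 𝔪] ⊆ 𝔥`, for the Levi-Civita connection `t = 1/2`
    ((∀ U V, M.bracketM U V = 0) → ∀ g,
      M.dirac c Z (1 / 2) (M.dirac c Z (1 / 2) ψ) g =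
        M.casimirG c Z X Y ψ g + ((1 / 8 : ℝ) * M.scal Z (1 / 2)) • ψ g) := by
  have hscal := fun t => M.scal_eq (Z := Z) hQ t
  have hsq := fun g => NaturallyReductive.Space.dirac_dirac_third c hH hQ hZ S hXY hψ g
  have hsq' : ∀ g, M.dirac c Z (1 / 3) (M.dirac c Z (1 / 3) ψ) g =
      M.casimirG c Z X Y ψ g +
        ((1 / 8 : ℝ) * (M.scal Z (1 / 3) + (1 / 9) * M.sumQM Q Z)) • ψ g := by
    intro g
    rw [hsq, hscal]
    ring_nf
  refine ⟨fun g => ?_, M.degreeFourTerm_third, hsq, hsq', fun hsymm g => ?_⟩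
  · rw [NaturallyReductive.Space.firstOrderTerm]
    norm_num
  · -- if brackets of `𝔪` lie in `𝔥`, all the connections `∇^t` coincide
    have hΛ : M.connectionMap (1 / 2) = M.connectionMap (1 / 3) := by
      funext U V
      rw [NaturallyReductive.Space.connectionMap, NaturallyReductive.Space.connectionMap, hsymm,
        smul_zero, smul_zero]
    have hD : M.dirac c Z (1 / 2) = M.dirac c Z (1 / 3) := by
      funext φ x
      simp only [NaturallyReductive.Space.dirac, NaturallyReductive.Space.covDeriv, hΛ]
    have hQM : M.sumQM Q Z = 0 := by
      simp [NaturallyReductive.Space.sumQM, hsymm]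
    rw [hD, hsq, hscal, hQM]
    ring_nf
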